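/- Let $(\Omega,\mathcal F,P)$ be a probability space with a filtration $(\mathcal F_n)_{n\ge 0}$, and let $(S_n)_{n\ge 0}$ be a real martingale with respect to it with $S_0=0$ a.s. Put $x_n=S_n-S_{n-1}$ for $n\ge1$, and suppose that for every $n\ge 1$ there is an $\mathcal F_{n-1}$-measurable real random variable $c_n$ with $|x_n|\le c_n$ a.s. Let $A_n\ge 0$ be given by $A_n^2=\sum_{i=1}^n x_i^2$. Let $\psi$ be a positive, non-decreasing and continuous real function on $[1,\infty)$ (extended in any way to a real function on $\mathbb R$), and let $$I(\psi)=\int_1^\infty \psi(\lambda)\,e^{-\psi(\lambda)^2/2}\,\frac{d\lambda}{\lambda}\in[0,\infty].$$ Let $B$ be the event that $\lim_n A_n=\infty$ and $\limsup_n c_n\,\psi(A_n^2)^3/A_n<\infty$. 1. If $I(\psi)<\infty$, then for $P$-almost every $\omega\in B$ we have $S_n<A_n\psi(A_n^2)$ for all sufficiently large $n$. 2. If $I(\psi)=\infty$ and $\psi(\lambda)\to\infty$ as $\lambda\to\infty$, then for $P$-almost every $\omega\in B$ we have $S_n\ge A_n\psi(A_n^2)$ for infinitely many $n$. (When $P(B)>0$,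 the conclusions say that the respective events have conditional probability $1$ given $B$.) -/

import Mathlib

open MeasureTheory ProbabilityTheory Filter

namespace SelfNormalized

noncomputable section

/-- The integral `I(ψ) = ∫₁^∞ ψ(t) exp(-ψ(t)² / 2) dt / t`, with values in `[0, ∞]`. -/
def efkpIntegral (ψ : ℝ → ℝ) : ENNReal :=
  ∫⁻ t in Set.Ici (1 : ℝ), ENNReal.ofReal (ψ t * Real.exp (-(ψ t) ^ 2 / 2) / t)

/-- The increment `x_n = S_n - S_{n-1}`; used for `n ≥ 1` only. -/
def increment {Ω : Type*} (S : ℕ → Ω → ℝ) (n : ℕ) (ω : Ω) : ℝ :=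
  S n ω - S (n - 1) ω

/-- The squared normalizer `A_n² = x_1² + ⋯ + x_n²`. -/
def quadVar {Ω : Type*} (S : ℕ → Ω → ℝ) (n : ℕ) (ω : Ω) : ℝ :=
  ∑ i ∈ Finset.Icc 1 n, (increment S i ω) ^ 2

/-- The normalizer `A_n ≥ 0`. -/
def normalizer {Ω : Type*} (S : ℕ → Ω → ℝ) (n : ℕ) (ω : Ω) : ℝ :=
  Real.sqrt (quadVar S n ω)

/-- The event `{ lim A_n = ∞, limsup c_n ψ(A_n²)³ / A_n < ∞ }`; the upper limit is taken in the
extended reals. -/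
def growthEvent {Ω : Type*} (S c : ℕ → Ω → ℝ) (ψ : ℝ → ℝ) : Set Ω :=
  {ω | Tendsto (fun n => normalizer S n ω) atTop atTop ∧
    limsup (fun n => ((c n ω * (ψ (quadVar S n ω)) ^ 3 / normalizer S n ω : ℝ) : EReal)) atTop
      < ⊤}

end

end SelfNormalized

/-
Think of `x_n` as the outcome of the `n`-th round of a fair game: betting the previsible amount
`b_n` per unit of wealth produces the martingale `∏ (1 + b_i x_i)`, and since
`log (1 + y) = y - y² / 2 + O(|y|³)` its logarithm is `λ S_n - λ² A_n² / 2`, up to a bounded error,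
for a constant bet `λ = y / A_n`; the condition `c_n = O(A_n / ψ(A_n²)³)` is what makes the cubic
terms bounded. In the logarithmic time `t = log A_n²` the boundary becomes `θ(t) = ψ(exp t)` and
the integral becomes `∫ θ exp(-θ² / 2) dt`.

If the integral converges, take times `t_k` with gaps `1 / y_k`, where the levels `y_k` follow `θ`
from below. A crossing of the boundary between `t_k` and `t_{k+1}` raises the wealth of the bet
`y_k exp(-t_k / 2)` to a constant times `exp(y_k² / 2)`. Ville's inequality bounds the probability
of this by a constant times `exp(-y_k² / 2)`, which is summable.

If the integral diverges, attach a bet to each of finitely many such times, with stakes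
`exp(-θ(t_k)² / 2)` adding up to at least `1`. As long as the boundary is not crossed their joint
wealth stays bounded, and if it is never crossed the joint wealth ends up below `1 / 2`. The
conditional probability, given the past, of never crossing is therefore at most some `ρ < 1`, and
Lévy's zero-one law makes it vanish.
-/

namespace SelfNormalized

section LogExpansion

lemma abs_log_one_add_sub_le {y : ℝ} (hy : |y| ≤ 1 / 2) :
    |Real.log (1 + y) - (y - y ^ 2 / 2)| ≤ 2 * |y| * y ^ 2 := by
  have taylor : |-y + y ^ 2 / 2 + Real.log (1 + y)| ≤ |y| ^ 3 / (1 - |y|) := by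
    have h := Real.abs_log_sub_add_sum_range_le (x := -y) (by rw [abs_neg]; linarith) 2
    norm_num [Finset.sum_range_succ] at h
    exact h
  have remainder : |y| ^ 3 / (1 - |y|) ≤ 2 * |y| * y ^ 2 := by
    rw [div_le_iff₀ (by linarith), ← sq_abs y]
    nlinarith [pow_nonneg (abs_nonneg y) 3]
  calc |Real.log (1 + y) - (y - y ^ 2 / 2)| = |-y + y ^ 2 / 2 + Real.log (1 + y)| := by
        congr 1; ring
    _ ≤ _ := taylor.trans remainder

lemma one_add_mem_Icc_exp {y δ : ℝ} (hδ : δ ≤ 1 / 2) (hy : |y| ≤ δ) :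
    1 + y ∈ Set.Icc (Real.exp (y - (1 / 2 + 2 * δ) * y ^ 2))
      (Real.exp (y - (1 / 2 - 2 * δ) * y ^ 2)) := by
  have hlog := abs_le.1 (abs_log_one_add_sub_le (hy.trans hδ))
  have hpos : 0 < 1 + y := by linarith [neg_abs_le y]
  have hsq := mul_le_mul_of_nonneg_right hy (sq_nonneg y)
  rw [Set.mem_Icc, ← Real.le_log_iff_exp_le hpos, ← Real.log_le_iff_le_exp hpos]
  constructor <;> linarith [hlog.1, hlog.2]

variable {ι : Type*} {s : Finset ι} {y : ι → ℝ} {δ : ℝ}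

lemma prod_one_add_le_exp (hδ : δ ≤ 1 / 2) (h : ∀ i ∈ s, |y i| ≤ δ) :
    ∏ i ∈ s, (1 + y i) ≤ Real.exp (∑ i ∈ s, y i - (1 / 2 - 2 * δ) * ∑ i ∈ s, y i ^ 2) := by
  rw [Finset.mul_sum, ← Finset.sum_sub_distrib, Real.exp_sum]
  exact Finset.prod_le_prod (fun i hi => by linarith [neg_abs_le (y i), h i hi])
    fun i hi => (one_add_mem_Icc_exp hδ (h i hi)).2

lemma exp_le_prod_one_add (hδ : δ ≤ 1 / 2) (h : ∀ i ∈ s, |y i| ≤ δ) :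
    Real.exp (∑ i ∈ s, y i - (1 / 2 + 2 * δ) * ∑ i ∈ s, y i ^ 2) ≤ ∏ i ∈ s, (1 + y i) := by
  rw [Finset.mul_sum, ← Finset.sum_sub_distrib, Real.exp_sum]
  exact Finset.prod_le_prod (fun i _ => (Real.exp_pos _).le)
    fun i hi => (one_add_mem_Icc_exp hδ (h i hi)).1

end LogExpansion

section QuadVar

variable {Ω : Type*} {S : ℕ → Ω → ℝ}

lemma quadVar_eq_sum_range (n : ℕ) (ω : Ω) :
    quadVar S n ω = ∑ i ∈ Finset.range n, (S (i + 1) ω - S i ω) ^ 2 := by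
  rw [Finset.range_eq_Ico]
  exact (Finset.sum_Ico_add' (fun i => increment S i ω ^ 2) 0 n 1).symm

lemma quadVar_succ (n : ℕ) (ω : Ω) :
    quadVar S (n + 1) ω = quadVar S n ω + (S (n + 1) ω - S n ω) ^ 2 := by
  simp only [quadVar_eq_sum_range, Finset.sum_range_succ]

lemma quadVar_nonneg (n : ℕ) (ω : Ω) : 0 ≤ quadVar S n ω :=
  Finset.sum_nonneg fun _ _ => sq_nonneg _

lemma monotone_quadVar (ω : Ω) : Monotone fun n => quadVar S n ω :=
  monotone_nat_of_le_succ fun n => by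
    rw [quadVar_succ]
    exact le_add_of_nonneg_right (sq_nonneg _)

lemma quadVar_sub_eq_sum_Ico {m n : ℕ} (hmn : m ≤ n) (ω : Ω) :
    quadVar S n ω - quadVar S m ω = ∑ i ∈ Finset.Ico m n, (S (i + 1) ω - S i ω) ^ 2 := by
  rw [quadVar_eq_sum_range, quadVar_eq_sum_range, Finset.sum_Ico_eq_sub _ hmn]

lemma normalizer_nonneg (n : ℕ) (ω : Ω) : 0 ≤ normalizer S n ω :=
  Real.sqrt_nonneg _

lemma normalizer_sq (n : ℕ) (ω : Ω) : normalizer S n ω ^ 2 = quadVar S n ω :=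
  Real.sq_sqrt (quadVar_nonneg n ω)

lemma measurable_quadVar {mΩ : MeasurableSpace Ω} {ℱ : Filtration ℕ mΩ}
    (hS : StronglyAdapted ℱ S) (n : ℕ) : Measurable[ℱ n] (quadVar S n) := by
  rw [show quadVar S n = fun ω => ∑ i ∈ Finset.range n, (S (i + 1) ω - S i ω) ^ 2 from
    funext (quadVar_eq_sum_range n)]
  refine Finset.measurable_sum _ fun i hi => ?_
  have hi := Finset.mem_range.1 hi
  exact (((hS (i + 1)).mono (ℱ.mono hi)).measurable.sub
    ((hS i).mono (ℱ.mono hi.le)).measurable).pow_const 2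

lemma tendsto_quadVar_of_mem_growthEvent {c : ℕ → Ω → ℝ} {ψ : ℝ → ℝ} {ω : Ω}
    (h : ω ∈ growthEvent S c ψ) : Tendsto (fun n => quadVar S n ω) atTop atTop :=
  ((tendsto_pow_atTop two_ne_zero).comp h.1).congr fun n => normalizer_sq n ω

end QuadVar

section Wealth

/-- The wealth of a gambler who starts with `1` and bets the fraction `b i` of the current wealth
on the increment `S (i + 1) - S i`. -/
def wealth {Ω : Type*} (S b : ℕ → Ω → ℝ) (n : ℕ) (ω : Ω) : ℝ :=
  ∏ i ∈ Finset.range n, (1 + b i ω * (S (i + 1) ω - S i ω))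

/-- A betting strategy which is predictable and never risks more than half of the wealth. The
fraction `b i` is bet on the increment `S (i + 1) - S i`, so predictability is measurability with
respect to `ℱ i`. -/
structure IsSafeBet {Ω : Type*} {mΩ : MeasurableSpace Ω} (ℱ : Filtration ℕ mΩ) (P : Measure Ω)
    (S b : ℕ → Ω → ℝ) : Prop where
  measurable : ∀ i, Measurable[ℱ i] (b i)
  abs_mul_le : ∀ i, ∀ᵐ ω ∂P, |b i ω * (S (i + 1) ω - S i ω)| ≤ 1 / 2

variable {Ω : Type*} {mΩ : MeasurableSpace Ω} {P : Measure Ω} {ℱ : Filtration ℕ mΩ}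
  {S b : ℕ → Ω → ℝ}

lemma wealth_zero (ω : Ω) : wealth S b 0 ω = 1 :=
  Finset.prod_range_zero _

lemma wealth_succ (n : ℕ) (ω : Ω) :
    wealth S b (n + 1) ω = wealth S b n ω * (1 + b n ω * (S (n + 1) ω - S n ω)) :=
  Finset.prod_range_succ _ _

lemma wealth_eq_of_eq_zero {m n : ℕ} (hmn : m ≤ n) {ω : Ω}
    (h : ∀ i ∈ Finset.Ico m n, b i ω = 0) : wealth S b n ω = wealth S b m ω := by
  rw [wealth, ← Finset.prod_range_mul_prod_Ico _ hmn, ← wealth,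
    Finset.prod_eq_one fun i hi => by rw [h i hi, zero_mul, add_zero], mul_one]

lemma wealth_eq_one_of_eq_zero {n : ℕ} {ω : Ω} (h : ∀ i < n, b i ω = 0) : wealth S b n ω = 1 :=
  (wealth_eq_of_eq_zero n.zero_le fun i hi => h i (Finset.mem_Ico.1 hi).2).trans (wealth_zero ω)

lemma wealth_nonneg {ω : Ω} (h : ∀ i, |b i ω * (S (i + 1) ω - S i ω)| ≤ 1 / 2) (n : ℕ) :
    0 ≤ wealth S b n ω :=
  Finset.prod_nonneg fun i _ => by linarith [(abs_le.1 (h i)).1]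

lemma wealth_succ_le {ω : Ω} (h : ∀ i, |b i ω * (S (i + 1) ω - S i ω)| ≤ 1 / 2) (n : ℕ) :
    wealth S b (n + 1) ω ≤ 3 / 2 * wealth S b n ω := by
  rw [wealth_succ, mul_comm]
  exact mul_le_mul_of_nonneg_right (by linarith [(abs_le.1 (h n)).2]) (wealth_nonneg h n)

lemma abs_indicator_mul_le {A : Set Ω} {ω : Ω} {lam x ε : ℝ} (hε : 0 ≤ ε)
    (h : ω ∈ A → |lam * x| ≤ ε) : |A.indicator (fun _ => lam) ω * x| ≤ ε := by
  by_cases hω : ω ∈ A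
  · rw [Set.indicator_of_mem hω]
    exact h hω
  · rwa [Set.indicator_of_notMem hω, zero_mul, abs_zero]

section ConstantStake

variable {m n : ℕ} {ω : Ω} {lam δ : ℝ}

lemma wealth_eq_prod_Ico (hmn : m ≤ n) (hzero : ∀ i < m, b i ω = 0)
    (hlam : ∀ i ∈ Finset.Ico m n, b i ω = lam) :
    wealth S b n ω = ∏ i ∈ Finset.Ico m n, (1 + lam * (S (i + 1) ω - S i ω)) := by
  rw [wealth, ← Finset.prod_range_mul_prod_Ico _ hmn, ← wealth, wealth_eq_one_of_eq_zero hzero,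
    one_mul]
  exact Finset.prod_congr rfl fun i hi => by rw [hlam i hi]

lemma sum_Ico_mul_increment (hmn : m ≤ n) :
    ∑ i ∈ Finset.Ico m n, lam * (S (i + 1) ω - S i ω) = lam * (S n ω - S m ω) := by
  rw [← Finset.mul_sum, Finset.sum_Ico_sub (fun i => S i ω) hmn]

lemma sum_Ico_sq_mul_increment (hmn : m ≤ n) :
    ∑ i ∈ Finset.Ico m n, (lam * (S (i + 1) ω - S i ω)) ^ 2 =
      lam ^ 2 * (quadVar S n ω - quadVar S m ω) := by
  simp only [quadVar_sub_eq_sum_Ico hmn, mul_pow, Finset.mul_sum]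

lemma wealth_le_exp (hmn : m ≤ n) (hzero : ∀ i < m, b i ω = 0)
    (hlam : ∀ i ∈ Finset.Ico m n, b i ω = lam) (hδ : δ ≤ 1 / 2)
    (hx : ∀ i ∈ Finset.Ico m n, |lam * (S (i + 1) ω - S i ω)| ≤ δ) :
    wealth S b n ω ≤ Real.exp (lam * (S n ω - S m ω) -
      (1 / 2 - 2 * δ) * (lam ^ 2 * (quadVar S n ω - quadVar S m ω))) := by
  rw [wealth_eq_prod_Ico hmn hzero hlam, ← sum_Ico_mul_increment hmn,
    ← sum_Ico_sq_mul_increment hmn]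
  exact prod_one_add_le_exp hδ hx

lemma exp_le_wealth (hmn : m ≤ n) (hzero : ∀ i < m, b i ω = 0)
    (hlam : ∀ i ∈ Finset.Ico m n, b i ω = lam) (hδ : δ ≤ 1 / 2)
    (hx : ∀ i ∈ Finset.Ico m n, |lam * (S (i + 1) ω - S i ω)| ≤ δ) :
    Real.exp (lam * (S n ω - S m ω) -
      (1 / 2 + 2 * δ) * (lam ^ 2 * (quadVar S n ω - quadVar S m ω))) ≤ wealth S b n ω := by
  rw [wealth_eq_prod_Ico hmn hzero hlam, ← sum_Ico_mul_increment hmn,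
    ← sum_Ico_sq_mul_increment hmn]
  exact exp_le_prod_one_add hδ hx

end ConstantStake

namespace IsSafeBet

lemma of_indicator {A : ℕ → Set Ω} {lam : ℝ} (hA : ∀ i, MeasurableSet[ℱ i] (A i))
    (h : ∀ i, ∀ᵐ ω ∂P, ω ∈ A i → |lam * (S (i + 1) ω - S i ω)| ≤ 1 / 2) :
    IsSafeBet ℱ P S fun i => (A i).indicator fun _ => lam where
  measurable i := measurable_const.indicator (hA i)
  abs_mul_le i := (h i).mono fun _ hω => abs_indicator_mul_le one_half_pos.le hω

lemma ae_wealth_nonneg (hb : IsSafeBet ℱ P S b) : ∀ᵐ ω ∂P, ∀ n, 0 ≤ wealth S b n ω :=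
  (ae_all_iff.2 hb.abs_mul_le).mono fun _ hω n => wealth_nonneg hω n

lemma stronglyMeasurable_wealth (hb : IsSafeBet ℱ P S b) (hS : StronglyAdapted ℱ S) (n : ℕ) :
    StronglyMeasurable[ℱ n] (wealth S b n) := by
  refine Finset.stronglyMeasurable_fun_prod _ fun i hi => ?_
  have hi : i < n := Finset.mem_range.1 hi
  exact stronglyMeasurable_const.add (((hb.measurable i).stronglyMeasurable.mono
    (ℱ.mono hi.le)).mul (((hS (i + 1)).mono (ℱ.mono hi)).sub ((hS i).mono (ℱ.mono hi.le))))

variable [IsFiniteMeasure P]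

lemma integrable_wealth (hb : IsSafeBet ℱ P S b) (hS : StronglyAdapted ℱ S) (n : ℕ) :
    Integrable (wealth S b n) P := by
  refine Integrable.of_bound
    ((hb.stronglyMeasurable_wealth hS n).mono (ℱ.le n)).aestronglyMeasurable (2 ^ n) ?_
  filter_upwards [ae_all_iff.2 hb.abs_mul_le] with ω hω
  calc ‖wealth S b n ω‖ = ∏ i ∈ Finset.range n, |1 + b i ω * (S (i + 1) ω - S i ω)| :=
        Finset.abs_prod _ _
    _ ≤ ∏ _i ∈ Finset.range n, (2 : ℝ) := by
        refine Finset.prod_le_prod (fun i _ => abs_nonneg _) fun i _ => abs_le.2 ?_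
        constructor <;> linarith [(abs_le.1 (hω i)).1, (abs_le.1 (hω i)).2]
    _ = 2 ^ n := by rw [Finset.prod_const, Finset.card_range]

lemma martingale_wealth (hb : IsSafeBet ℱ P S b) (hS : Martingale S ℱ P) :
    Martingale (wealth S b) ℱ P := by
  have hint := hb.integrable_wealth hS.stronglyAdapted
  have hmeas := hb.stronglyMeasurable_wealth hS.stronglyAdapted
  refine martingale_of_condExp_sub_eq_zero_nat hmeas hint fun n => ?_
  have hΔ : Integrable (S (n + 1) - S n) P := (hS.integrable _).sub (hS.integrable _)
  have hfactor : wealth S b (n + 1) - wealth S b n =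
      (wealth S b n * b n) * (S (n + 1) - S n) := by
    ext ω
    simp only [Pi.sub_apply, Pi.mul_apply, wealth_succ]
    ring
  have hpull := condExp_mul_of_stronglyMeasurable_left (μ := P) (m := ℱ n)
    ((hmeas n).mul (hb.measurable n).stronglyMeasurable)
    (hfactor ▸ (hint (n + 1)).sub (hint n)) hΔ
  have hzero : P[S (n + 1) - S n | ℱ n] =ᵐ[P] 0 := by
    filter_upwards [condExp_sub (hS.integrable (n + 1)) (hS.integrable n) (ℱ n),
      hS.condExp_ae_eq (Nat.le_succ n), hS.condExp_ae_eq (le_refl n)] with ω hsub hsucc hself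
    rw [hsub, Pi.sub_apply, hsucc, hself, sub_self, Pi.zero_apply]
  rw [hfactor]
  filter_upwards [hpull, hzero] with ω hpullω hzeroω
  rw [hpullω, Pi.mul_apply, hzeroω, Pi.zero_apply, mul_zero]

lemma setIntegral_wealth (hb : IsSafeBet ℱ P S b) (hS : Martingale S ℱ P) {m n : ℕ} (hmn : m ≤ n)
    (hzero : ∀ i < m, ∀ ω, b i ω = 0) {F : Set Ω} (hF : MeasurableSet[ℱ m] F) :
    ∫ ω in F, wealth S b n ω ∂P = P.real F := by
  rw [← (hb.martingale_wealth hS).setIntegral_eq hmn hF,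
    funext fun ω => wealth_eq_one_of_eq_zero fun i hi => hzero i hi ω, setIntegral_const,
    smul_eq_mul, mul_one]

end IsSafeBet

end Wealth

section Ville

variable {Ω : Type*} {mΩ : MeasurableSpace Ω} {P : Measure Ω} [IsFiniteMeasure P]
  {ℱ : Filtration ℕ mΩ} {M : ℕ → Ω → ℝ} {ε : ℝ}

lemma measure_exists_le_le_of_nonneg_martingale (hM : Martingale M ℱ P)
    (hM0 : ∀ n, 0 ≤ᵐ[P] M n) (hε : 0 < ε) (n : ℕ) :
    P {ω | ∃ k ≤ n, ε ≤ M k ω} ≤ ENNReal.ofReal (P[M 0] / ε) := by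
  have hmean : P[(M⁺) n] = P[M 0] := by
    have hconst := hM.setIntegral_eq n.zero_le MeasurableSet.univ
    rw [setIntegral_univ, setIntegral_univ] at hconst
    rw [hconst]
    exact integral_congr_ae ((hM0 n).mono fun ω hω => posPart_eq_self.2 hω)
  have hpos : 0 ≤ M⁺ := fun _ _ => posPart_nonneg _
  have hsub : Submartingale M⁺ ℱ P := hM.submartingale.pos
  lift ε to NNReal using hε.le
  have hdoob := maximal_ineq hsub hpos (ε := ε) n
  set E := {ω | (ε : ℝ) ≤ (Finset.range (n + 1)).sup' Finset.nonempty_range_add_one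
    fun k => (M⁺) k ω}
  have hsubset : {ω | ∃ k ≤ n, (ε : ℝ) ≤ M k ω} ⊆ E := fun ω ⟨k, hk, hω⟩ =>
    (hω.trans (le_posPart _)).trans
      (Finset.le_sup' (fun k => (M⁺) k ω) (Finset.mem_range.2 (Nat.lt_succ_of_le hk)))
  rw [ENNReal.ofReal_div_of_pos hε, ENNReal.ofReal_coe_nnreal]
  refine ENNReal.le_div_iff_mul_le (Or.inl (by exact_mod_cast hε.ne')) (Or.inl ENNReal.coe_ne_top)
    |>.2 ?_
  calc P {ω | ∃ k ≤ n, (ε : ℝ) ≤ M k ω} * ε ≤ ε * P E := by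
        rw [mul_comm]
        gcongr
    _ ≤ ENNReal.ofReal (∫ ω in E, (M⁺) n ω ∂P) := hdoob
    _ ≤ ENNReal.ofReal (P[M 0]) := by
        rw [← hmean]
        exact ENNReal.ofReal_le_ofReal
          (setIntegral_le_integral (hsub.integrable n) (ae_of_all _ (hpos n)))

theorem ville_inequality (hM : Martingale M ℱ P) (hM0 : ∀ n, 0 ≤ᵐ[P] M n) (hε : 0 < ε) :
    P {ω | ∃ n, ε ≤ M n ω} ≤ ENNReal.ofReal (P[M 0] / ε) := by
  have hunion : {ω | ∃ n, ε ≤ M n ω} = ⋃ n, {ω | ∃ k ≤ n, ε ≤ M k ω} := by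
    ext ω
    simp only [Set.mem_ofPred_eq, Set.mem_iUnion]
    exact ⟨fun ⟨n, hn⟩ => ⟨n, n, le_rfl, hn⟩, fun ⟨_, k, _, hk⟩ => ⟨k, hk⟩⟩
  have hmono : Monotone fun n => {ω | ∃ k ≤ n, ε ≤ M k ω} :=
    fun _ _ hmn _ ⟨k, hk, hω⟩ => ⟨k, hk.trans hmn, hω⟩
  rw [hunion, hmono.measure_iUnion]
  exact iSup_le (measure_exists_le_le_of_nonneg_martingale hM hM0 hε)

lemma IsSafeBet.measure_exists_le_wealth_le {S b : ℕ → Ω → ℝ} (hb : IsSafeBet ℱ P S b)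
    (hS : Martingale S ℱ P) (hε : 0 < ε) :
    P {ω | ∃ n, ε ≤ wealth S b n ω} ≤ ENNReal.ofReal (P.real Set.univ * ε⁻¹) := by
  have hville := ville_inequality (hb.martingale_wealth hS)
    (fun n => hb.ae_wealth_nonneg.mono fun ω hω => hω n) hε
  simpa [wealth_zero, div_eq_mul_inv] using hville

lemma ae_eventually_wealth_lt {S : ℕ → Ω → ℝ} {b : ℕ → ℕ → Ω → ℝ}
    (hb : ∀ k, IsSafeBet ℱ P S (b k)) (hS : Martingale S ℱ P) {a : ℕ → ℝ}
    (ha : ∀ k, 0 < a k) (hsum : Summable fun k => (a k)⁻¹) :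
    ∀ᵐ ω ∂P, ∀ᶠ k in atTop, ∀ n, wealth S (b k) n ω < a k := by
  have htsum : ∑' k, P {ω | ∃ n, a k ≤ wealth S (b k) n ω} ≠ ⊤ :=
    ne_top_of_le_ne_top (hsum.mul_left (P.real Set.univ)).tsum_ofReal_ne_top
      (ENNReal.tsum_le_tsum fun k => (hb k).measure_exists_le_wealth_le hS (ha k))
  filter_upwards [ae_eventually_notMem htsum] with ω hω
  exact hω.mono fun k hk n => not_le.1 fun hle => hk ⟨n, hle⟩

end Ville

section LogScale

/-- The boundary `ψ` in the logarithmic scale, made constant on the negative half-line, where `ψ` is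
not controlled. -/
noncomputable def logProfile (ψ : ℝ → ℝ) (t : ℝ) : ℝ :=
  ψ (Real.exp (max t 0))

/-- The density `v * exp (-v² / 2)` whose integral along the logarithmic profile is `I(ψ)`. -/
noncomputable def gaussianWeight (v : ℝ) : ℝ :=
  v * Real.exp (-v ^ 2 / 2)

lemma gaussianWeight_nonneg {v : ℝ} (hv : 0 ≤ v) : 0 ≤ gaussianWeight v :=
  mul_nonneg hv (Real.exp_pos _).le

lemma antitoneOn_gaussianWeight : AntitoneOn gaussianWeight (Set.Ici 1) := by
  intro v hv w _ hvw
  have hv : 1 ≤ v := hv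
  have hgap : w ≤ v * Real.exp ((w ^ 2 - v ^ 2) / 2) := by
    have hlin : w ≤ v * ((w ^ 2 - v ^ 2) / 2 + 1) := by
      nlinarith [mul_nonneg (sub_nonneg.2 hvw) (by nlinarith : 0 ≤ v * (w + v) / 2 - 1)]
    exact hlin.trans (mul_le_mul_of_nonneg_left (Real.add_one_le_exp _) (by linarith))
  calc w * Real.exp (-w ^ 2 / 2)
      ≤ v * Real.exp ((w ^ 2 - v ^ 2) / 2) * Real.exp (-w ^ 2 / 2) := by gcongr
    _ = v * Real.exp (-v ^ 2 / 2) := by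
        rw [mul_assoc, ← Real.exp_add]
        ring_nf

variable {ψ : ℝ → ℝ}

lemma logProfile_of_nonneg {t : ℝ} (ht : 0 ≤ t) : logProfile ψ t = ψ (Real.exp t) := by
  rw [logProfile, max_eq_left ht]

lemma monotone_logProfile (hmono : MonotoneOn ψ (Set.Ici 1)) : Monotone (logProfile ψ) :=
  fun _ _ hst => hmono (Real.one_le_exp (le_max_right _ _)) (Real.one_le_exp (le_max_right _ _))
    (Real.exp_le_exp.2 (max_le_max_right 0 hst))

lemma logProfile_pos (hpos : ∀ t ∈ Set.Ici (1 : ℝ), 0 < ψ t) (t : ℝ) : 0 < logProfile ψ t :=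
  hpos _ (Real.one_le_exp (le_max_right _ _))

lemma tendsto_logProfile_iff : Tendsto (logProfile ψ) atTop atTop ↔ Tendsto ψ atTop atTop := by
  rw [← Real.tendsto_comp_exp_atTop (f := ψ)]
  exact tendsto_congr' ((eventually_ge_atTop 0).mono fun t ht => logProfile_of_nonneg ht)

lemma efkpIntegral_eq_lintegral_logProfile (ψ : ℝ → ℝ) :
    efkpIntegral ψ =
      ∫⁻ t in Set.Ici (0 : ℝ), ENNReal.ofReal (gaussianWeight (logProfile ψ t)) := by
  have himage : Real.exp '' Set.Ici 0 = Set.Ici 1 := by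
    ext u
    refine ⟨fun ⟨t, ht, hu⟩ => hu ▸ Real.one_le_exp ht, fun hu => ?_⟩
    exact ⟨Real.log u, Real.log_nonneg hu, Real.exp_log (zero_lt_one.trans_le hu)⟩
  rw [efkpIntegral, ← himage, lintegral_image_eq_lintegral_abs_deriv_mul measurableSet_Ici
    (fun t _ => (Real.hasDerivAt_exp t).hasDerivWithinAt) Real.exp_injective.injOn]
  refine setLIntegral_congr_fun measurableSet_Ici fun t ht => ?_
  rw [abs_of_pos (Real.exp_pos t), ← ENNReal.ofReal_mul (Real.exp_pos t).le,
    mul_div_cancel₀ _ (Real.exp_pos t).ne', logProfile_of_nonneg ht, gaussianWeight]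

variable {θ : ℝ → ℝ}

lemma ofReal_mul_gaussianWeight_le_setLIntegral (hθ : Monotone θ) {s t : ℝ} (hs : 1 ≤ θ s)
    (hst : s ≤ t) :
    ENNReal.ofReal ((t - s) * gaussianWeight (θ t)) ≤
      ∫⁻ u in Set.Ico s t, ENNReal.ofReal (gaussianWeight (θ u)) := by
  rw [mul_comm, ENNReal.ofReal_mul (gaussianWeight_nonneg (by linarith [hθ hst])),
    ← Real.volume_Ico, ← setLIntegral_const]
  refine setLIntegral_mono' measurableSet_Ico fun u hu => ENNReal.ofReal_le_ofReal ?_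
  exact antitoneOn_gaussianWeight (hs.trans (hθ hu.1)) (hs.trans (hθ hst)) (hθ hu.2.le)

lemma setLIntegral_le_ofReal_mul_gaussianWeight (hθ : Monotone θ) {s t y : ℝ} (hy : 1 ≤ y)
    (hys : y ≤ θ s) :
    ∫⁻ u in Set.Ico s t, ENNReal.ofReal (gaussianWeight (θ u)) ≤
      ENNReal.ofReal ((t - s) * gaussianWeight y) := by
  rw [mul_comm, ENNReal.ofReal_mul (gaussianWeight_nonneg (by linarith)), ← Real.volume_Ico,
    ← setLIntegral_const]
  refine setLIntegral_mono' measurableSet_Ico fun u hu => ENNReal.ofReal_le_ofReal ?_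
  have hyu : y ≤ θ u := hys.trans (hθ hu.1)
  exact antitoneOn_gaussianWeight hy (hy.trans hyu) hyu

lemma tendsto_atTop_of_lintegral_gaussianWeight_lt_top (hθ : Monotone θ) (hpos : 0 < θ 0)
    (hI : ∫⁻ t in Set.Ici (0 : ℝ), ENNReal.ofReal (gaussianWeight (θ t)) < ⊤) :
    Tendsto θ atTop atTop := by
  refine tendsto_atTop_atTop.2 fun M => ?_
  by_contra! hcon
  have hbdd : ∀ t, θ t ≤ M := fun t => by
    obtain ⟨s, hts, hs⟩ := hcon t
    exact (hθ hts).trans hs.le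
  set ε := θ 0 * Real.exp (-M ^ 2 / 2) with hε
  have hlower : ENNReal.ofReal ε * volume (Set.Ici (0 : ℝ)) ≤
      ∫⁻ t in Set.Ici (0 : ℝ), ENNReal.ofReal (gaussianWeight (θ t)) := by
    rw [← setLIntegral_const]
    refine setLIntegral_mono' measurableSet_Ici fun t ht => ENNReal.ofReal_le_ofReal ?_
    have h0t : θ 0 ≤ θ t := hθ ht
    have hsq : θ t ^ 2 ≤ M ^ 2 := pow_le_pow_left₀ (hpos.le.trans h0t) (hbdd t) 2
    rw [hε, gaussianWeight]
    gcongr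
    exact hpos.le.trans h0t
  rw [Real.volume_Ici, ENNReal.mul_top (ENNReal.ofReal_pos.2 (by positivity)).ne'] at hlower
  exact (hlower.trans_lt hI).ne rfl

end LogScale

section Clock

/-- The logarithm of `A_n²`, truncated below at `t₀`; the clock in which the boundary is
`logProfile ψ`. -/
noncomputable def logClock {Ω : Type*} (S : ℕ → Ω → ℝ) (t₀ : ℝ) (n : ℕ) (ω : Ω) : ℝ :=
  Real.log (max (quadVar S n ω) (Real.exp t₀))

variable {Ω : Type*} {S : ℕ → Ω → ℝ} {t₀ : ℝ}

lemma exp_logClock (n : ℕ) (ω : Ω) :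
    Real.exp (logClock S t₀ n ω) = max (quadVar S n ω) (Real.exp t₀) :=
  Real.exp_log (lt_max_of_lt_right (Real.exp_pos _))

lemma quadVar_le_exp_logClock (n : ℕ) (ω : Ω) :
    quadVar S n ω ≤ Real.exp (logClock S t₀ n ω) := by
  rw [exp_logClock]
  exact le_max_left _ _

lemma exp_logClock_le (n : ℕ) (ω : Ω) :
    Real.exp (logClock S t₀ n ω) ≤ quadVar S n ω + Real.exp t₀ := by
  rw [exp_logClock]
  exact max_le_add_of_nonneg (quadVar_nonneg n ω) (Real.exp_pos _).le

lemma exp_logClock_succ_le (n : ℕ) (ω : Ω) :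
    Real.exp (logClock S t₀ (n + 1) ω) ≤
      Real.exp (logClock S t₀ n ω) + (S (n + 1) ω - S n ω) ^ 2 := by
  rw [exp_logClock, exp_logClock, quadVar_succ, max_add]
  exact max_le_max_left _ (le_add_of_nonneg_right (sq_nonneg _))

lemma exp_logClock_of_le {n : ℕ} {ω : Ω} (h : Real.exp t₀ ≤ quadVar S n ω) :
    Real.exp (logClock S t₀ n ω) = quadVar S n ω := by
  rw [exp_logClock, max_eq_left h]

lemma normalizer_eq_exp_logClock {n : ℕ} {ω : Ω} (h : Real.exp t₀ ≤ quadVar S n ω) :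
    normalizer S n ω = Real.exp (logClock S t₀ n ω / 2) := by
  rw [normalizer, ← exp_logClock_of_le h, Real.exp_half]

lemma le_logClock (n : ℕ) (ω : Ω) : t₀ ≤ logClock S t₀ n ω := by
  rw [← Real.exp_le_exp, exp_logClock]
  exact le_max_right _ _

lemma monotone_logClock (ω : Ω) : Monotone fun n => logClock S t₀ n ω := fun m n hmn => by
  rw [← Real.exp_le_exp, exp_logClock, exp_logClock]
  exact max_le_max_right _ (monotone_quadVar ω hmn)

lemma logProfile_logClock {ψ : ℝ → ℝ} (ht₀ : 0 ≤ t₀) {n : ℕ} {ω : Ω}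
    (h : Real.exp t₀ ≤ quadVar S n ω) :
    logProfile ψ (logClock S t₀ n ω) = ψ (quadVar S n ω) := by
  rw [logProfile_of_nonneg (ht₀.trans (le_logClock n ω)), exp_logClock_of_le h]

lemma measurable_logClock {mΩ : MeasurableSpace Ω} {ℱ : Filtration ℕ mΩ}
    (hS : StronglyAdapted ℱ S) (n : ℕ) : Measurable[ℱ n] (logClock S t₀ n) :=
  Real.measurable_log.comp ((measurable_quadVar hS n).max measurable_const)

lemma tendsto_logClock {ω : Ω} (h : Tendsto (fun n => quadVar S n ω) atTop atTop) :
    Tendsto (fun n => logClock S t₀ n ω) atTop atTop :=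
  Real.tendsto_log_atTop.comp (tendsto_atTop_mono (fun _ => le_max_left _ _) h)

end Clock

section StepBound

variable {Ω : Type*} {S c : ℕ → Ω → ℝ} {ψ : ℝ → ℝ} {ω : Ω}

lemma exists_eventually_mul_le_normalizer (hω : ω ∈ growthEvent S c ψ) :
    ∃ K ≥ 1, ∀ᶠ n in atTop, c n ω * ψ (quadVar S n ω) ^ 3 ≤ K * normalizer S n ω := by
  obtain ⟨M, hM, -⟩ := EReal.lt_iff_exists_real_btwn.1 hω.2
  refine ⟨max M 1, le_max_right _ _, ?_⟩
  filter_upwards [eventually_lt_of_limsup_lt hM, hω.1.eventually_gt_atTop 0] with n hn hA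
  exact (div_le_iff₀ hA).1 ((EReal.coe_lt_coe_iff.1 hn).le.trans (le_max_left _ _))

lemma normalizer_succ_le_two_mul {n : ℕ}
    (h : |S (n + 1) ω - S n ω| ≤ normalizer S (n + 1) ω / 2) :
    normalizer S (n + 1) ω ≤ 2 * normalizer S n ω := by
  have hsq : (S (n + 1) ω - S n ω) ^ 2 ≤ (normalizer S (n + 1) ω / 2) ^ 2 := by
    rw [← sq_abs]
    exact pow_le_pow_left₀ (abs_nonneg _) h 2
  have hQ := quadVar_succ (S := S) n ω
  rw [← normalizer_sq, ← normalizer_sq] at hQ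
  exact le_of_sq_le_sq (by nlinarith) (mul_nonneg zero_le_two (normalizer_nonneg n ω))

lemma exists_eventually_step_le (hmono : MonotoneOn ψ (Set.Ici 1)) (htop : Tendsto ψ atTop atTop)
    (hx : ∀ i, |S (i + 1) ω - S i ω| ≤ c (i + 1) ω) (hω : ω ∈ growthEvent S c ψ) :
    ∃ K, ∀ᶠ n in atTop, c (n + 1) ω * ψ (quadVar S n ω) ^ 3 ≤ K * normalizer S n ω := by
  obtain ⟨K, hK1, hK⟩ := exists_eventually_mul_le_normalizer hω
  have hQ := tendsto_quadVar_of_mem_growthEvent hω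
  refine ⟨K * 2, ?_⟩
  filter_upwards [(tendsto_add_atTop_nat 1).eventually hK, hQ.eventually_ge_atTop 1,
    (htop.comp hQ).eventually_ge_atTop (2 * K)] with n hstep hone hψ
  have hc : 0 ≤ c (n + 1) ω := (abs_nonneg _).trans (hx n)
  have hQmono := monotone_quadVar (S := S) ω n.le_succ
  have hψmono : ψ (quadVar S n ω) ≤ ψ (quadVar S (n + 1) ω) := hmono hone (hone.trans hQmono) hQmono
  have hψ : 2 * K ≤ ψ (quadVar S n ω) := hψ
  have hgain : c (n + 1) ω * ψ (quadVar S n ω) ^ 3 ≤ K * normalizer S (n + 1) ω :=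
    (by gcongr; linarith : _ ≤ c (n + 1) ω * ψ (quadVar S (n + 1) ω) ^ 3).trans hstep
  have hcA : c (n + 1) ω ≤ normalizer S (n + 1) ω / 2 := by
    have hcube : 2 * K ≤ ψ (quadVar S n ω) ^ 3 :=
      hψ.trans (le_self_pow₀ (by linarith) three_ne_zero)
    nlinarith [mul_le_mul_of_nonneg_left hcube hc]
  have hA := normalizer_succ_le_two_mul ((hx n).trans hcA)
  calc _ ≤ K * normalizer S (n + 1) ω := hgain
    _ ≤ K * (2 * normalizer S n ω) := by gcongr
    _ = _ := by ring

lemma exists_step_bound (hmono : MonotoneOn ψ (Set.Ici 1)) (htop : Tendsto ψ atTop atTop)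
    {t₀ : ℝ} (ht₀ : 0 ≤ t₀) (hx : ∀ i, |S (i + 1) ω - S i ω| ≤ c (i + 1) ω)
    (hω : ω ∈ growthEvent S c ψ) :
    ∃ C : ℕ, 1 ≤ C ∧ ∀ i, c (i + 1) ω * logProfile ψ (logClock S t₀ i ω) ^ 3 ≤
      C * Real.exp (logClock S t₀ i ω / 2) := by
  obtain ⟨K, hK⟩ := exists_eventually_step_le hmono htop hx hω
  have hQ := tendsto_quadVar_of_mem_growthEvent hω
  have hratio : ∀ᶠ n in atTop, c (n + 1) ω * logProfile ψ (logClock S t₀ n ω) ^ 3 /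
      Real.exp (logClock S t₀ n ω / 2) ≤ K := by
    filter_upwards [hK, hQ.eventually_ge_atTop (Real.exp t₀)] with n hn hq
    rw [div_le_iff₀ (Real.exp_pos _), logProfile_logClock ht₀ hq, ← normalizer_eq_exp_logClock hq]
    exact hn
  obtain ⟨B, hB⟩ := IsBoundedUnder.bddAbove_range (isBoundedUnder_of_eventually_le hratio)
  obtain ⟨C, hC⟩ := exists_nat_ge (max B 1)
  refine ⟨C, by exact_mod_cast (le_max_right _ _).trans hC, fun i => ?_⟩
  rw [← div_le_iff₀ (Real.exp_pos _)]
  exact (hB ⟨i, rfl⟩).trans ((le_max_left B 1).trans hC)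

end StepBound

section BetSize

variable {θ : ℝ → ℝ} {D C τ h c : ℝ}

lemma pow_four_mul_exp_le (hD : 0 < D) (hh : h ≤ τ - 8 * Real.log D) :
    D ^ 4 * Real.exp (h / 2) ≤ Real.exp (τ / 2) := by
  have hD4 : D ^ 4 = Real.exp (4 * Real.log D) := by
    rw [mul_comm, Real.exp_mul, Real.exp_log hD]
    norm_cast
  rw [hD4, ← Real.exp_add, Real.exp_le_exp]
  linarith

lemma exp_two_lt_eight : Real.exp 2 < 8 := by
  rw [show (2 : ℝ) = (2 : ℕ) * 1 by norm_num, Real.exp_nat_mul]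
  nlinarith [Real.exp_one_lt_d9, Real.exp_pos 1]

/-- The bet size of the level `D = θ τ` is `D / exp (τ / 2)`. Well before the time `τ` the clock is
so small that the trivial bound on `c` suffices; later `θ h` is comparable with `D`. -/
lemma div_exp_mul_le (hθ : Monotone θ) (hC : 0 ≤ C) (hD : 1 ≤ D)
    (hreg : D ≤ 3 * θ (τ - 8 * Real.log D)) (hh : h ≤ τ + 4) (hc0 : 0 ≤ c) (hθ1 : 1 ≤ θ h)
    (hc : c * θ h ^ 3 ≤ C * Real.exp (h / 2)) :
    D / Real.exp (τ / 2) * c ≤ 216 * C / D ^ 2 := by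
  rw [div_mul_eq_mul_div, div_le_div_iff₀ (Real.exp_pos _) (by positivity)]
  rcases le_total h (τ - 8 * Real.log D) with hearly | hlate
  · calc D * c * D ^ 2 = c * D ^ 3 := by ring
      _ ≤ c * θ h ^ 3 * D ^ 4 := by
          gcongr
          · exact le_mul_of_one_le_right hc0 (one_le_pow₀ hθ1)
          · norm_num
      _ ≤ C * (D ^ 4 * Real.exp (h / 2)) := by nlinarith [pow_pos (zero_lt_one.trans_le hD) 4]
      _ ≤ C * Real.exp (τ / 2) := by gcongr; exact pow_four_mul_exp_le (by linarith) hearly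
      _ ≤ 216 * C * Real.exp (τ / 2) := by gcongr; linarith
  · have hDθ : D ≤ 3 * θ h := hreg.trans (by linarith [hθ hlate])
    have hexp : Real.exp (h / 2) ≤ 8 * Real.exp (τ / 2) :=
      calc Real.exp (h / 2) ≤ Real.exp (2 + τ / 2) := Real.exp_le_exp.2 (by linarith)
        _ ≤ 8 * Real.exp (τ / 2) := by rw [Real.exp_add]; gcongr; exact exp_two_lt_eight.le
    calc D * c * D ^ 2 = c * D ^ 3 := by ring
      _ ≤ c * (3 * θ h) ^ 3 := by gcongr
      _ = 27 * (c * θ h ^ 3) := by ring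
      _ ≤ 27 * (C * (8 * Real.exp (τ / 2))) := by gcongr 27 * ?_; exact hc.trans (by gcongr)
      _ = 216 * C * Real.exp (τ / 2) := by ring

end BetSize

section SlowGrid

lemma exists_mem_Ico_of_tendsto_atTop {t : ℕ → ℝ} (ht : Tendsto t atTop atTop) {s : ℝ}
    (hs : t 0 ≤ s) : ∃ j, s ∈ Set.Ico (t j) (t (j + 1)) := by
  by_contra! hcon
  have hle : ∀ j, t j ≤ s := fun j => by
    induction j with
    | zero => exact hs
    | succ j ih => exact not_lt.1 fun hlt => hcon j ⟨ih, hlt⟩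
  obtain ⟨j, hj⟩ := (ht.eventually_gt_atTop s).exists
  exact (hle j).not_gt hj

lemma summable_of_le_add_mul {s b : ℕ → ℝ} {ρ : ℝ} (hs : ∀ k, 0 ≤ s k) (hb0 : ∀ k, 0 ≤ b k)
    (hb : Summable b) (hρ : ρ < 1) (h : ∀ k, s (k + 1) ≤ b k + ρ * s k) :
    Summable s := by
  refine summable_of_sum_range_le (c := (s 0 + ∑' k, b k) / (1 - ρ)) hs fun n => ?_
  rw [le_div_iff₀ (by linarith)]
  have hshift : ∑ i ∈ Finset.range n, s (i + 1) ≤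
      ∑ i ∈ Finset.range n, b i + ρ * ∑ i ∈ Finset.range n, s i := by
    rw [Finset.mul_sum, ← Finset.sum_add_distrib]
    exact Finset.sum_le_sum fun i _ => h i
  linarith [hb.sum_le_tsum (Finset.range n) fun i _ => hb0 i, hs n,
    Finset.sum_range_succ s n, Finset.sum_range_succ' s n]

lemma tsum_setLIntegral_Ico_le {t : ℕ → ℝ} (ht : Monotone t) (f : ℝ → ENNReal) :
    ∑' k, ∫⁻ u in Set.Ico (t k) (t (k + 1)), f u ≤ ∫⁻ u in Set.Ici (t 0), f u := by
  have hdisj : Pairwise (Function.onFun Disjoint fun k => Set.Ico (t k) (t (k + 1))) :=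
    ht.pairwise_disjoint_on_Ico_succ
  rw [← lintegral_iUnion (fun _ => measurableSet_Ico) hdisj]
  exact lintegral_mono_set (Set.iUnion_subset fun k u hu => (ht k.zero_le).trans hu.1)

/-- A grid of times together with a level at each time, starting from `(t₀, θ t₀)`. The time step
is the inverse of the level, and the level follows `θ` from below but never grows faster than by
the time step. -/
noncomputable def slowGrid (θ : ℝ → ℝ) (t₀ : ℝ) : ℕ → ℝ × ℝ
  | 0 => (t₀, θ t₀)
  | k + 1 =>
    let p := slowGrid θ t₀ k
    (p.1 + 1 / p.2, min (θ (p.1 + 1 / p.2)) (p.2 + 1 / p.2))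

/-- The times of `slowGrid`. -/
noncomputable def slowTime (θ : ℝ → ℝ) (t₀ : ℝ) (k : ℕ) : ℝ := (slowGrid θ t₀ k).1

/-- The levels of `slowGrid`. -/
noncomputable def slowLevel (θ : ℝ → ℝ) (t₀ : ℝ) (k : ℕ) : ℝ := (slowGrid θ t₀ k).2

variable {θ : ℝ → ℝ} {t₀ : ℝ}

lemma slowTime_succ (k : ℕ) :
    slowTime θ t₀ (k + 1) = slowTime θ t₀ k + 1 / slowLevel θ t₀ k :=
  rfl

lemma slowLevel_succ (k : ℕ) :
    slowLevel θ t₀ (k + 1) =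
      min (θ (slowTime θ t₀ (k + 1))) (slowLevel θ t₀ k + 1 / slowLevel θ t₀ k) :=
  rfl

lemma slowLevel_succ_le (k : ℕ) :
    slowLevel θ t₀ (k + 1) ≤ slowLevel θ t₀ k + 1 / slowLevel θ t₀ k :=
  min_le_right _ _

lemma slowLevel_le (k : ℕ) : slowLevel θ t₀ k ≤ θ (slowTime θ t₀ k) := by
  cases k with
  | zero => exact le_rfl
  | succ k => exact min_le_left _ _

lemma monotone_slowTime_sub_slowLevel :
    Monotone fun k => slowTime θ t₀ k - slowLevel θ t₀ k :=
  monotone_nat_of_le_succ fun k => by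
    rw [slowTime_succ]
    linarith [slowLevel_succ_le (θ := θ) (t₀ := t₀) k]

variable (hθ : Monotone θ) (hθ₀ : 1 ≤ θ t₀)
include hθ hθ₀

lemma one_le_slowLevel (k : ℕ) : 1 ≤ slowLevel θ t₀ k := by
  induction k with
  | zero => exact hθ₀
  | succ k ih =>
    have hstep : 0 < 1 / slowLevel θ t₀ k := by positivity
    rw [slowLevel_succ, slowTime_succ]
    refine le_min ((ih.trans (slowLevel_le k)).trans (hθ ?_)) (by linarith)
    exact le_add_of_nonneg_right hstep.le

lemma one_div_slowLevel_pos (k : ℕ) : 0 < 1 / slowLevel θ t₀ k :=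
  one_div_pos.2 (zero_lt_one.trans_le (one_le_slowLevel hθ hθ₀ k))

lemma one_div_slowLevel_le_one (k : ℕ) : 1 / slowLevel θ t₀ k ≤ 1 :=
  div_le_one_of_le₀ (one_le_slowLevel hθ hθ₀ k) (by linarith [one_le_slowLevel hθ hθ₀ k])

lemma strictMono_slowTime : StrictMono (slowTime θ t₀) :=
  strictMono_nat_of_lt_succ fun k => lt_add_of_pos_right _ (one_div_slowLevel_pos hθ hθ₀ k)

lemma monotone_slowLevel : Monotone (slowLevel θ t₀) :=
  monotone_nat_of_le_succ fun k => le_min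
    ((slowLevel_le k).trans (hθ ((strictMono_slowTime hθ hθ₀).monotone k.le_succ)))
    (le_add_of_nonneg_right (one_div_slowLevel_pos hθ hθ₀ k).le)

lemma ofReal_exp_neg_sq_le_setLIntegral (k : ℕ) :
    ENNReal.ofReal (Real.exp (-θ (slowTime θ t₀ (k + 1)) ^ 2 / 2)) ≤
      ∫⁻ u in Set.Ico (slowTime θ t₀ k) (slowTime θ t₀ (k + 1)),
        ENNReal.ofReal (gaussianWeight (θ u)) := by
  have hy := one_le_slowLevel hθ hθ₀ k
  have hmono := (strictMono_slowTime hθ hθ₀).monotone k.le_succ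
  refine le_trans (ENNReal.ofReal_le_ofReal ?_)
    (ofReal_mul_gaussianWeight_le_setLIntegral hθ (hy.trans (slowLevel_le k)) hmono)
  have hlevel : slowLevel θ t₀ k ≤ θ (slowTime θ t₀ (k + 1)) := (slowLevel_le k).trans (hθ hmono)
  rw [gaussianWeight, ← mul_assoc, slowTime_succ, add_sub_cancel_left, ← slowTime_succ,
    one_div_mul_eq_div]
  exact le_mul_of_one_le_left (Real.exp_pos _).le ((one_le_div (by linarith)).2 hlevel)

lemma summable_exp_neg_sq_slowTime (ht₀ : 0 ≤ t₀)
    (hI : ∫⁻ t in Set.Ici (0 : ℝ), ENNReal.ofReal (gaussianWeight (θ t)) < ⊤) :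
    Summable fun k => Real.exp (-θ (slowTime θ t₀ (k + 1)) ^ 2 / 2) := by
  have hle : ∑' k, ENNReal.ofReal (Real.exp (-θ (slowTime θ t₀ (k + 1)) ^ 2 / 2)) ≤
      ∫⁻ t in Set.Ici (0 : ℝ), ENNReal.ofReal (gaussianWeight (θ t)) :=
    calc _ ≤ ∑' k, ∫⁻ u in Set.Ico (slowTime θ t₀ k) (slowTime θ t₀ (k + 1)),
            ENNReal.ofReal (gaussianWeight (θ u)) :=
          ENNReal.tsum_le_tsum (ofReal_exp_neg_sq_le_setLIntegral hθ hθ₀)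
      _ ≤ _ := tsum_setLIntegral_Ico_le (strictMono_slowTime hθ hθ₀).monotone _
      _ ≤ _ := lintegral_mono_set (Set.Ici_subset_Ici.2 ht₀)
  exact (ENNReal.summable_toReal (hle.trans_lt hI).ne).congr fun k =>
    ENNReal.toReal_ofReal (Real.exp_pos _).le

/-- A level is either on the boundary, or it has grown by its inverse, which divides its Gaussian
weight by `e`. -/
lemma summable_exp_neg_sq_slowLevel (ht₀ : 0 ≤ t₀)
    (hI : ∫⁻ t in Set.Ici (0 : ℝ), ENNReal.ofReal (gaussianWeight (θ t)) < ⊤) :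
    Summable fun k => Real.exp (-slowLevel θ t₀ k ^ 2 / 2) := by
  refine summable_of_le_add_mul (ρ := Real.exp (-1)) (fun k => (Real.exp_pos _).le)
    (fun k => (Real.exp_pos _).le) (summable_exp_neg_sq_slowTime hθ hθ₀ ht₀ hI)
    (by simp) fun k => ?_
  rw [← Real.exp_add]
  set y := slowLevel θ t₀ k
  have hlevel := slowLevel_succ (θ := θ) (t₀ := t₀) k
  rcases min_choice (θ (slowTime θ t₀ (k + 1))) (y + 1 / y) with hmin | hmin
  · rw [hlevel, hmin]
    exact le_add_of_nonneg_right (Real.exp_pos _).le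
  · refine le_add_of_nonneg_of_le (Real.exp_pos _).le (Real.exp_le_exp.2 ?_)
    have hy1 := one_le_slowLevel hθ hθ₀ k
    have hcancel : y * (1 / y) = 1 := mul_one_div_cancel (by linarith)
    rw [hlevel, hmin]
    nlinarith [sq_nonneg (1 / y)]

lemma tendsto_slowLevel (ht₀ : 0 ≤ t₀)
    (hI : ∫⁻ t in Set.Ici (0 : ℝ), ENNReal.ofReal (gaussianWeight (θ t)) < ⊤) :
    Tendsto (slowLevel θ t₀) atTop atTop := by
  refine tendsto_atTop_atTop_of_monotone (monotone_slowLevel hθ hθ₀) fun B => ?_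
  obtain ⟨k, hk⟩ := ((summable_exp_neg_sq_slowLevel hθ hθ₀ ht₀ hI).tendsto_atTop_zero
    |>.eventually_lt_const (Real.exp_pos (-B ^ 2 / 2))).exists
  have hsq : B ^ 2 ≤ slowLevel θ t₀ k ^ 2 := by linarith [Real.exp_lt_exp.1 hk]
  exact ⟨k, (abs_le_of_sq_le_sq' hsq (by linarith [one_le_slowLevel hθ hθ₀ k])).2⟩

omit hθ hθ₀ in
lemma slowLevel_le_slowTime_add (k : ℕ) :
    slowLevel θ t₀ k ≤ slowTime θ t₀ k + (θ t₀ - t₀) := by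
  have h : t₀ - θ t₀ ≤ slowTime θ t₀ k - slowLevel θ t₀ k :=
    monotone_slowTime_sub_slowLevel k.zero_le
  linarith

omit hθ hθ₀ in
lemma tendsto_slowTime (hy : Tendsto (slowLevel θ t₀) atTop atTop) :
    Tendsto (slowTime θ t₀) atTop atTop :=
  tendsto_atTop_mono (fun k => by linarith [slowLevel_le_slowTime_add (θ := θ) (t₀ := t₀) k])
    (tendsto_atTop_add_const_right _ (-(θ t₀ - t₀)) hy)

lemma tendsto_slowLevel_div_exp (hy : Tendsto (slowLevel θ t₀) atTop atTop) :
    Tendsto (fun k => slowLevel θ t₀ k / Real.exp (slowTime θ t₀ k / 2)) atTop (nhds 0) := by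
  have hx : Tendsto (fun k => slowTime θ t₀ k / 2) atTop atTop :=
    (tendsto_slowTime hy).atTop_div_const two_pos
  have hbound : Tendsto (fun k => (slowTime θ t₀ k + (θ t₀ - t₀)) / Real.exp (slowTime θ t₀ k / 2))
      atTop (nhds 0) := by
    have h1 := ((Real.tendsto_pow_mul_exp_neg_atTop_nhds_zero 1).comp hx).const_mul 2
    have h2 := (Real.tendsto_exp_neg_atTop_nhds_zero.comp hx).const_mul (θ t₀ - t₀)
    rw [mul_zero] at h1 h2
    refine (add_zero (0 : ℝ) ▸ h1.add h2).congr fun k => ?_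
    simp only [Function.comp_apply, Real.exp_neg]
    ring
  refine squeeze_zero (fun k => ?_) (fun k => ?_) hbound
  · exact div_nonneg (by linarith [one_le_slowLevel hθ hθ₀ k]) (Real.exp_pos _).le
  · gcongr
    exact slowLevel_le_slowTime_add k

/-- The level `y k` drops by at most `8 * log (y k) + 1` in the time needed to go back from
`slowTime θ t₀ k` by `8 * log (y k)`. -/
lemma eventually_slowLevel_le_three_mul (hy : Tendsto (slowLevel θ t₀) atTop atTop) :
    ∀ᶠ k in atTop, slowLevel θ t₀ k ≤
      3 * θ (slowTime θ t₀ k - 8 * Real.log (slowLevel θ t₀ k)) := by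
  have hlog : ∀ᶠ u : ℝ in atTop, Real.log u ≤ u / 24 := by
    filter_upwards [Real.isLittleO_log_id_atTop.bound (show (0 : ℝ) < 1 / 24 by norm_num),
      eventually_ge_atTop 1] with u hu hu1
    rw [Real.norm_of_nonneg (Real.log_nonneg hu1), id, Real.norm_of_nonneg (by linarith)] at hu
    linarith
  filter_upwards [hy.eventually hlog, hy.eventually_ge_atTop 3,
    hy.eventually_ge_atTop (3 * θ t₀)] with k hlogk hk3 hk0
  set s := slowTime θ t₀ k - 8 * Real.log (slowLevel θ t₀ k)
  have hs : slowTime θ t₀ 0 ≤ s := by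
    change t₀ ≤ s
    linarith [slowLevel_le_slowTime_add (θ := θ) (t₀ := t₀) k]
  obtain ⟨j, hj1, hj2⟩ := exists_mem_Ico_of_tendsto_atTop (tendsto_slowTime hy) hs
  have hjk : j ≤ k := (strictMono_slowTime hθ hθ₀).le_iff_le.1
    (hj1.trans (sub_le_self _ (by linarith [Real.log_nonneg (one_le_slowLevel hθ hθ₀ k)])))
  have hgrowth : slowTime θ t₀ j - slowLevel θ t₀ j ≤ slowTime θ t₀ k - slowLevel θ t₀ k :=
    monotone_slowTime_sub_slowLevel hjk
  rw [slowTime_succ] at hj2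
  linarith [(slowLevel_le j).trans (hθ hj1), one_div_slowLevel_le_one hθ hθ₀ j]

end SlowGrid

section Upper

variable {Ω : Type*} {S c : ℕ → Ω → ℝ}

/-- The bet of constant size `lam`, placed only when the announced bound makes it safe. -/
noncomputable def cautiousBet {Ω : Type*} (c : ℕ → Ω → ℝ) (lam : ℝ) (i : ℕ) : Ω → ℝ :=
  {ω | lam * c (i + 1) ω ≤ 1 / 2}.indicator fun _ => lam

lemma abs_mul_increment_le {lam ε : ℝ} (hlam : 0 ≤ lam) {i : ℕ} {ω : Ω}
    (hx : |S (i + 1) ω - S i ω| ≤ c (i + 1) ω) (hc : lam * c (i + 1) ω ≤ ε) :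
    |lam * (S (i + 1) ω - S i ω)| ≤ ε := by
  rw [abs_mul, abs_of_nonneg hlam]
  exact (mul_le_mul_of_nonneg_left hx hlam).trans hc

lemma isSafeBet_cautiousBet {mΩ : MeasurableSpace Ω} {P : Measure Ω} {ℱ : Filtration ℕ mΩ}
    (hc : ∀ i, Measurable[ℱ i] (c (i + 1)))
    (hx : ∀ᵐ ω ∂P, ∀ i, |S (i + 1) ω - S i ω| ≤ c (i + 1) ω) {lam : ℝ} (hlam : 0 ≤ lam) :
    IsSafeBet ℱ P S (cautiousBet c lam) :=
  .of_indicator (fun i => measurableSet_le ((hc i).const_mul lam) measurable_const) fun i =>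
    hx.mono fun _ hω => abs_mul_increment_le hlam (hω i)

lemma mul_exp_half_sub_le_one {y s : ℝ} (hy : 1 ≤ y) (hs0 : 0 ≤ s) (hs : s ≤ 1 / y) :
    y * (Real.exp (s / 2) - 1) ≤ 1 := by
  have hy1 : 1 / y ≤ 1 := (div_le_one (by linarith)).2 hy
  have hexp := Real.abs_exp_sub_one_le (x := s / 2) (by rw [abs_of_nonneg (by linarith)]; linarith)
  rw [abs_of_nonneg (by linarith : 0 ≤ s / 2)] at hexp
  calc y * (Real.exp (s / 2) - 1) ≤ y * (1 / y) := by
        gcongr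
        linarith [le_abs_self (Real.exp (s / 2) - 1)]
    _ = 1 := mul_one_div_cancel (by linarith)

/-- With `r = exp ((h - τ) / 2)`, the main term is at least
`y² r - y² r² / 2 = y² / 2 - (y (r - 1))² / 2`. -/
lemma le_crossing_exponent {y v τ h δ : ℝ} (hy : 1 ≤ y) (hyv : y ≤ v) (hτ : τ ≤ h)
    (hτ' : h ≤ τ + 1 / y) (hδ : 0 ≤ δ) :
    y ^ 2 / 2 - 1 / 2 - 6 * (δ * y ^ 2) ≤
      y / Real.exp (τ / 2) * (Real.exp (h / 2) * v) -
        (1 / 2 + 2 * δ) * ((y / Real.exp (τ / 2)) ^ 2 * Real.exp h) := by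
  set r := Real.exp ((h - τ) / 2) with hr
  have hratio : y / Real.exp (τ / 2) * Real.exp (h / 2) = y * r := by
    rw [hr, sub_div, Real.exp_sub]
    ring
  have hratio_sq : (y / Real.exp (τ / 2)) ^ 2 * Real.exp h = (y * r) ^ 2 := by
    rw [← hratio, mul_pow, ← Real.exp_nat_mul]
    congr 2
    push_cast
    ring
  have hr1 : 1 ≤ r := Real.one_le_exp (by linarith)
  have hyr : y * (r - 1) ≤ 1 := mul_exp_half_sub_le_one hy (by linarith) (by linarith)
  have hr3 : r ^ 2 ≤ 3 := by
    have hy1 : 1 / y ≤ 1 := (div_le_one (by linarith)).2 hy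
    rw [hr, ← Real.exp_nat_mul]
    calc Real.exp _ ≤ Real.exp 1 := Real.exp_le_exp.2 (by push_cast; linarith)
      _ ≤ 3 := by linarith [Real.exp_one_lt_d9]
  have hsquare : (y * (r - 1)) ^ 2 ≤ 1 :=
    pow_le_one₀ (mul_nonneg (by linarith) (by linarith)) hyr
  have hmain : y * r * y ≤ y * r * v := by gcongr
  have herror : δ * y ^ 2 * r ^ 2 ≤ δ * y ^ 2 * 3 := by gcongr
  rw [← mul_assoc (y / _), hratio, hratio_sq]
  linarith

lemma exp_le_wealth_cautiousBet {θ : ℝ → ℝ} (hθ : Monotone θ) {t₀ τ y C : ℝ} (hθ₀ : 1 ≤ θ t₀)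
    (hC : 1 ≤ C) (hCy : 432 * C ≤ y) (hyθ : y ≤ θ τ) (hreg : y ≤ 3 * θ (τ - 8 * Real.log y))
    {ω : Ω} {n : ℕ} (hx : ∀ i, |S (i + 1) ω - S i ω| ≤ c (i + 1) ω)
    (hstep : ∀ i, c (i + 1) ω * θ (logClock S t₀ i ω) ^ 3 ≤ C * Real.exp (logClock S t₀ i ω / 2))
    (hQ : Real.exp t₀ ≤ quadVar S n ω) (hτ : τ ≤ logClock S t₀ n ω)
    (hτ' : logClock S t₀ n ω ≤ τ + 1 / y) (hS0 : y / Real.exp (τ / 2) * S 0 ω ≤ 1)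
    (hS : Real.exp (logClock S t₀ n ω / 2) * θ (logClock S t₀ n ω) ≤ S n ω) :
    Real.exp (y ^ 2 / 2 - 3 / 2 - 1296 * C) ≤
      wealth S (cautiousBet c (y / Real.exp (τ / 2))) n ω := by
  set lam := y / Real.exp (τ / 2) with hlam
  set δ := 216 * C / y ^ 2 with hδ
  have hy : 0 < y := by linarith
  have hlam0 : 0 ≤ lam := by positivity
  have hδ2 : δ ≤ 1 / 2 := by
    rw [hδ, div_le_iff₀ (by positivity)]
    nlinarith
  have hbet : ∀ i ∈ Finset.Ico 0 n, lam * c (i + 1) ω ≤ δ := fun i hi => by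
    have hclock := monotone_logClock (S := S) (t₀ := t₀) ω (Finset.mem_Ico.1 hi).2.le
    have h1y : 1 / y ≤ 1 := (div_le_one hy).2 (by linarith)
    exact div_exp_mul_le hθ (by linarith) (by linarith) hreg (by simp only at hclock; linarith)
      ((abs_nonneg _).trans (hx i)) (hθ₀.trans (hθ (le_logClock i ω))) (hstep i)
  refine le_trans (Real.exp_le_exp.2 ?_) (exp_le_wealth n.zero_le (by simp)
    (fun i hi => Set.indicator_of_mem (s := {ω | lam * c (i + 1) ω ≤ 1 / 2})
      ((hbet i hi).trans hδ2) _) hδ2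
    fun i hi => abs_mul_increment_le hlam0 (hx i) (hbet i hi))
  have hexponent := le_crossing_exponent (δ := δ) (by linarith) (hyθ.trans (hθ hτ)) hτ hτ'
    (by positivity)
  rw [exp_logClock_of_le hQ, ← hlam, div_mul_cancel₀ _ (by positivity)] at hexponent
  have hQ0 : quadVar S 0 ω = 0 := by simp [quadVar]
  rw [hQ0, sub_zero]
  linarith [mul_le_mul_of_nonneg_left hS hlam0]

lemma ae_forall_eventually_wealth_cautiousBet_lt {mΩ : MeasurableSpace Ω} {P : Measure Ω}
    [IsFiniteMeasure P] {ℱ : Filtration ℕ mΩ} (hS : Martingale S ℱ P)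
    (hc : ∀ i, Measurable[ℱ i] (c (i + 1)))
    (hx : ∀ᵐ ω ∂P, ∀ i, |S (i + 1) ω - S i ω| ≤ c (i + 1) ω) {y lam : ℕ → ℝ}
    (hlam : ∀ k, 0 ≤ lam k) (hsum : Summable fun k => Real.exp (-y k ^ 2 / 2)) :
    ∀ᵐ ω ∂P, ∀ C : ℕ, ∀ᶠ k in atTop, ∀ n,
      wealth S (cautiousBet c (lam k)) n ω < Real.exp (y k ^ 2 / 2 - 3 / 2 - 1296 * C) := by
  refine ae_all_iff.2 fun C => ae_eventually_wealth_lt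
    (fun k => isSafeBet_cautiousBet hc hx (hlam k)) hS (fun k => Real.exp_pos _) ?_
  refine (hsum.mul_left (Real.exp (3 / 2 + 1296 * C))).congr fun k => ?_
  rw [← Real.exp_neg, ← Real.exp_add]
  ring_nf

lemma eventually_lt_of_forall_eventually_wealth_lt {ψ : ℝ → ℝ}
    (hmono : MonotoneOn ψ (Set.Ici 1)) (htop : Tendsto ψ atTop atTop) {t₀ : ℝ} (ht₀ : 0 ≤ t₀)
    (hθ₀ : 1 ≤ logProfile ψ t₀) (hlevel : Tendsto (slowLevel (logProfile ψ) t₀) atTop atTop)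
    {ω : Ω} (hx : ∀ i, |S (i + 1) ω - S i ω| ≤ c (i + 1) ω) (hω : ω ∈ growthEvent S c ψ)
    (hwealth : ∀ C : ℕ, ∀ᶠ k in atTop, ∀ n, wealth S (cautiousBet c
      (slowLevel (logProfile ψ) t₀ k / Real.exp (slowTime (logProfile ψ) t₀ k / 2))) n ω <
        Real.exp (slowLevel (logProfile ψ) t₀ k ^ 2 / 2 - 3 / 2 - 1296 * C)) :
    ∀ᶠ n in atTop, S n ω < normalizer S n ω * ψ (quadVar S n ω) := by
  have hθ := monotone_logProfile hmono
  obtain ⟨C, hC1, hC⟩ := exists_step_bound hmono htop ht₀ hx hω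
  have hstart := (tendsto_slowLevel_div_exp hθ hθ₀ hlevel).mul_const (S 0 ω)
  rw [zero_mul] at hstart
  obtain ⟨K, hK⟩ := eventually_atTop.1 ((hwealth C).and
    ((eventually_slowLevel_le_three_mul hθ hθ₀ hlevel).and
      ((hlevel.eventually_ge_atTop (432 * (C : ℝ))).and (hstart.eventually_le_const one_pos))))
  have hQ := tendsto_quadVar_of_mem_growthEvent hω
  filter_upwards [hQ.eventually_ge_atTop (Real.exp t₀),
    (tendsto_logClock (t₀ := t₀) hQ).eventually_ge_atTop (slowTime (logProfile ψ) t₀ K)]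
    with n hn hclock
  by_contra! hcross
  rw [normalizer_eq_exp_logClock hn, ← logProfile_logClock (ψ := ψ) ht₀ hn] at hcross
  obtain ⟨k, hk, hk'⟩ := exists_mem_Ico_of_tendsto_atTop (tendsto_slowTime hlevel)
    (s := logClock S t₀ n ω) (le_logClock n ω)
  have hKk : K ≤ k := Nat.lt_succ_iff.1
    ((strictMono_slowTime hθ hθ₀).lt_iff_lt.1 (hclock.trans_lt hk'))
  obtain ⟨hlt, hreg, hCy, hS0⟩ := hK k hKk
  exact (hlt n).not_ge (exp_le_wealth_cautiousBet hθ hθ₀ (by exact_mod_cast hC1) hCy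
    (slowLevel_le k) hreg hx hC hn hk (slowTime_succ k ▸ hk'.le) hS0 hcross)

theorem ae_eventually_lt_of_efkpIntegral_lt_top {mΩ : MeasurableSpace Ω} {P : Measure Ω}
    [IsFiniteMeasure P] {ℱ : Filtration ℕ mΩ} {ψ : ℝ → ℝ} (hS : Martingale S ℱ P)
    (hc : ∀ i, Measurable[ℱ i] (c (i + 1)))
    (hx : ∀ᵐ ω ∂P, ∀ i, |S (i + 1) ω - S i ω| ≤ c (i + 1) ω)
    (hpos : ∀ t ∈ Set.Ici (1 : ℝ), 0 < ψ t) (hmono : MonotoneOn ψ (Set.Ici 1))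
    (hI : efkpIntegral ψ < ⊤) :
    ∀ᵐ ω ∂P, ω ∈ growthEvent S c ψ →
      ∀ᶠ n in atTop, S n ω < normalizer S n ω * ψ (quadVar S n ω) := by
  have hθ := monotone_logProfile hmono
  rw [efkpIntegral_eq_lintegral_logProfile] at hI
  have htop := tendsto_atTop_of_lintegral_gaussianWeight_lt_top hθ (logProfile_pos hpos 0) hI
  obtain ⟨t₀, hθ₀, ht₀⟩ := ((htop.eventually_ge_atTop 1).and (eventually_ge_atTop 0)).exists
  have hlevel := tendsto_slowLevel hθ hθ₀ ht₀ hI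
  filter_upwards [hx, ae_forall_eventually_wealth_cautiousBet_lt hS hc hx
    (fun k => div_nonneg (zero_le_one.trans (one_le_slowLevel hθ hθ₀ k)) (Real.exp_pos _).le)
    (summable_exp_neg_sq_slowLevel hθ hθ₀ ht₀ hI)] with ω hxω hwealth hω
  exact eventually_lt_of_forall_eventually_wealth_lt hmono (tendsto_logProfile_iff.1 htop) ht₀
    hθ₀ hlevel hxω hω hwealth

end Upper

section Sparse

lemma card_le_of_forall_lt_le_add {F : Finset ℕ} {d : ℕ}
    (h : ∀ k ∈ F, ∀ l ∈ F, k < l → l ≤ k + d) : F.card ≤ d + 1 := by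
  rcases F.eq_empty_or_nonempty with rfl | hne
  · simp
  have hsub : F ⊆ Finset.Icc (F.min' hne) (F.min' hne + d) := fun l hl => by
    refine Finset.mem_Icc.2 ⟨F.min'_le l hl, ?_⟩
    rcases (F.min'_le l hl).eq_or_lt with heq | hlt
    · omega
    · exact h _ (F.min'_mem hne) l hl hlt
  have hcard := Finset.card_le_card hsub
  rw [Nat.card_Icc] at hcard
  omega

lemma summable_indicator_exp_of_card_le {ι : Type*} {f : ι → ℝ} (hf : ∀ k, 0 ≤ f k) {s : Set ι}
    {N : ℕ → ℝ} (hN : Summable fun m : ℕ => N m * Real.exp (-m / 2))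
    (hcard : ∀ (m : ℕ) (F : Finset ι), (∀ k ∈ F, k ∈ s ∧ ⌊f k⌋₊ = m) → F.card ≤ N m) :
    Summable (s.indicator fun k => Real.exp (-f k / 2)) := by
  classical
  have hN0 : ∀ m, 0 ≤ N m * Real.exp (-(m : ℝ) / 2) := fun m =>
    mul_nonneg (by simpa using hcard m ∅ (by simp)) (Real.exp_pos _).le
  refine summable_of_sum_le (c := ∑' m : ℕ, N m * Real.exp (-(m : ℝ) / 2))
    (fun k => Set.indicator_nonneg (fun k _ => (Real.exp_pos _).le) k) fun u => ?_
  have hsum : ∑ k ∈ u, s.indicator (fun k => Real.exp (-f k / 2)) k =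
      ∑ k ∈ u with k ∈ s, Real.exp (-f k / 2) := by
    simp only [Set.indicator_apply, Finset.sum_filter]
  rw [hsum]
  set v := u.filter (· ∈ s)
  have hfiber : ∀ m, ∑ k ∈ v with ⌊f k⌋₊ = m, Real.exp (-f k / 2) ≤
      N m * Real.exp (-(m : ℝ) / 2) := fun m => by
    have hmem : ∀ k ∈ v.filter (⌊f ·⌋₊ = m), k ∈ s ∧ ⌊f k⌋₊ = m := fun k hk =>
      ⟨(Finset.mem_filter.1 (Finset.mem_filter.1 hk).1).2, (Finset.mem_filter.1 hk).2⟩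
    calc ∑ k ∈ v with ⌊f k⌋₊ = m, Real.exp (-f k / 2)
        ≤ ∑ k ∈ v with ⌊f k⌋₊ = m, Real.exp (-(m : ℝ) / 2) := by
          refine Finset.sum_le_sum fun k hk => Real.exp_le_exp.2 ?_
          linarith [(hmem k hk).2 ▸ Nat.floor_le (hf k)]
      _ = (v.filter (⌊f ·⌋₊ = m)).card * Real.exp (-(m : ℝ) / 2) := by
          rw [Finset.sum_const, nsmul_eq_mul]
      _ ≤ N m * Real.exp (-(m : ℝ) / 2) := by
          gcongr
          exact hcard m _ hmem
  rw [← Finset.sum_fiberwise_of_maps_to (t := v.image (⌊f ·⌋₊)) (g := (⌊f ·⌋₊))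
    fun k hk => Finset.mem_image_of_mem _ hk]
  exact (Finset.sum_le_sum fun m _ => hfiber m).trans (hN.sum_le_tsum _ fun m _ => hN0 m)

lemma summable_indicator_exp_of_sparse {f : ℕ → ℝ} (hf : ∀ k, 0 ≤ f k) {s : Set ℕ}
    (hs : ∀ k ∈ s, ∀ l ∈ s, k < l → ⌊f k⌋₊ = ⌊f l⌋₊ → (l : ℝ) - k ≤ 8 * f l) :
    Summable (s.indicator fun k => Real.exp (-f k / 2)) := by
  refine summable_indicator_exp_of_card_le (N := fun m => 8 * ((m : ℝ) + 1) + 1) hf ?_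
    fun m F hF => ?_
  · have h0 := Real.summable_pow_mul_exp_neg_nat_mul 0 (show (0 : ℝ) < 1 / 2 by norm_num)
    have h1 := Real.summable_pow_mul_exp_neg_nat_mul 1 (show (0 : ℝ) < 1 / 2 by norm_num)
    refine ((h1.mul_left 8).add (h0.mul_left 9)).congr fun m => ?_
    rw [show -(1 / 2 : ℝ) * m = -(m : ℝ) / 2 by ring]
    ring
  · have hcard : F.card ≤ 8 * (m + 1) + 1 := card_le_of_forall_lt_le_add fun k hk l hl hkl => by
      obtain ⟨hks, hkm⟩ := hF k hk
      obtain ⟨hls, hlm⟩ := hF l hl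
      have hfl := Nat.lt_floor_add_one (f l)
      rw [hlm] at hfl
      have hle : (l : ℝ) ≤ k + 8 * (m + 1) := by linarith [hs k hks l hls hkl (hkm.trans hlm.symm)]
      exact_mod_cast hle
    exact_mod_cast hcard

lemma summable_indicator_union {ι : Type*} {f : ι → ℝ} (hf : ∀ k, 0 ≤ f k) {s t : Set ι}
    (hs : Summable (s.indicator f)) (ht : Summable (t.indicator f)) :
    Summable ((s ∪ t).indicator f) :=
  (hs.add ht).of_nonneg_of_le (fun k => Set.indicator_nonneg (fun k _ => hf k) k) fun k => by
    rw [← Set.indicator_union_add_inter_apply]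
    exact le_add_of_nonneg_right (Set.indicator_nonneg (fun k _ => hf k) k)

lemma exists_sum_Ico_mem_Icc {f : ℕ → ℝ} (hf0 : ∀ k, 0 ≤ f k) (hf1 : ∀ k, f k ≤ 1)
    (hf : ¬ Summable f) (k₁ : ℕ) : ∃ n, ∑ k ∈ Finset.Ico k₁ n, f k ∈ Set.Icc (1 : ℝ) 2 := by
  classical
  have htend := (not_summable_iff_tendsto_nat_atTop_of_nonneg fun k => hf0 (k₁ + k)).1
    fun h => hf ((summable_nat_add_iff k₁).1 (h.congr fun k => by rw [add_comm]))
  have hex : ∃ n, 1 ≤ ∑ i ∈ Finset.range n, f (k₁ + i) := (htend.eventually_ge_atTop 1).exists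
  have hspec := Nat.find_spec hex
  obtain ⟨m, hm⟩ : ∃ m, Nat.find hex = m + 1 := Nat.exists_eq_succ_of_ne_zero fun h0 => by
    rw [h0, Finset.sum_range_zero] at hspec
    linarith
  have hmin := not_le.1 (Nat.find_min hex (by omega : m < Nat.find hex))
  rw [hm] at hspec
  refine ⟨k₁ + (m + 1), ?_⟩
  rw [Finset.sum_Ico_eq_sum_range, Nat.add_sub_cancel_left]
  exact ⟨hspec, by rw [Finset.sum_range_succ]; linarith [hf1 (k₁ + m)]⟩

end Sparse

section LowerGrid

lemma gaussianWeight_le_one (v : ℝ) : gaussianWeight v ≤ 1 := by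
  have hv : v ≤ Real.exp (v ^ 2 / 2) := by
    nlinarith [Real.add_one_le_exp (v ^ 2 / 2), sq_nonneg (v - 1)]
  calc v * Real.exp (-v ^ 2 / 2) ≤ Real.exp (v ^ 2 / 2) * Real.exp (-v ^ 2 / 2) := by gcongr
    _ = 1 := by rw [← Real.exp_add, neg_div, add_neg_cancel, Real.exp_zero]

/-- The grid of times starting from `t₀` whose steps are the inverses of the values of `θ`. -/
noncomputable def grid (θ : ℝ → ℝ) (t₀ : ℝ) : ℕ → ℝ
  | 0 => t₀
  | k + 1 => grid θ t₀ k + 1 / θ (grid θ t₀ k)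

/-- The initial capital of the bet attached to a grid point, which makes the sum of the capitals
comparable with the integral of the profile. -/
noncomputable def stake (θ : ℝ → ℝ) (t₀ : ℝ) (k : ℕ) : ℝ :=
  Real.exp (-θ (grid θ t₀ k) ^ 2 / 2)

/-- The indices of the grid points around which `θ` does not vary much. -/
def regularIndices (θ : ℝ → ℝ) (t₀ : ℝ) : Set ℕ :=
  {k | θ (grid θ t₀ k + 5) ^ 2 ≤ θ (grid θ t₀ k) ^ 2 + 1 ∧
    θ (grid θ t₀ k) ≤ 3 * θ (grid θ t₀ k - 8 * Real.log (θ (grid θ t₀ k)))}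

variable {θ : ℝ → ℝ} {t₀ : ℝ}

lemma stake_pos (k : ℕ) : 0 < stake θ t₀ k :=
  Real.exp_pos _

lemma stake_le_one (k : ℕ) : stake θ t₀ k ≤ 1 :=
  Real.exp_le_one_iff.2 (by linarith [sq_nonneg (θ (grid θ t₀ k))])

lemma grid_succ (k : ℕ) : grid θ t₀ (k + 1) = grid θ t₀ k + 1 / θ (grid θ t₀ k) :=
  rfl

variable (hθ : Monotone θ) (hθ₀ : 1 ≤ θ t₀)
include hθ hθ₀

lemma one_le_grid (k : ℕ) : 1 ≤ θ (grid θ t₀ k) := by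
  induction k with
  | zero => exact hθ₀
  | succ k ih => exact ih.trans (hθ (le_add_of_nonneg_right (by positivity)))

lemma strictMono_grid : StrictMono (grid θ t₀) :=
  strictMono_nat_of_lt_succ fun k =>
    lt_add_of_pos_right _ (one_div_pos.2 (zero_lt_one.trans_le (one_le_grid hθ hθ₀ k)))

lemma sub_le_mul_grid_sub {k l : ℕ} (hkl : k ≤ l) {y : ℝ} (hy : θ (grid θ t₀ l) ≤ y) :
    (l : ℝ) - k ≤ y * (grid θ t₀ l - grid θ t₀ k) := by
  induction l, hkl using Nat.le_induction with
  | base => simp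
  | succ l _ ih =>
    have hly : θ (grid θ t₀ l) ≤ y := (hθ ((strictMono_grid hθ hθ₀).monotone l.le_succ)).trans hy
    have hstep : 1 ≤ y * (1 / θ (grid θ t₀ l)) := by
      rwa [mul_one_div, one_le_div (zero_lt_one.trans_le (one_le_grid hθ hθ₀ l))]
    rw [grid_succ]
    push_cast
    linarith [ih hly]

lemma tendsto_grid : Tendsto (grid θ t₀) atTop atTop := by
  refine tendsto_atTop_atTop_of_monotone (strictMono_grid hθ hθ₀).monotone fun T => ?_
  by_contra! hcon
  obtain ⟨n, hn⟩ := exists_nat_gt (θ T * (T - t₀))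
  have hcount : (n : ℝ) - (0 : ℕ) ≤ θ T * (grid θ t₀ n - t₀) :=
    sub_le_mul_grid_sub hθ hθ₀ n.zero_le (hθ (hcon n).le)
  have hT : 1 ≤ θ T := hθ₀.trans (hθ (hcon 0).le)
  push_cast at hcount
  nlinarith [hcon n]

lemma lintegral_gaussianWeight_le :
    ∫⁻ t in Set.Ici (0 : ℝ), ENNReal.ofReal (gaussianWeight (θ t)) ≤
      ENNReal.ofReal t₀ + ∑' k, ENNReal.ofReal (stake θ t₀ k) := by
  have hcover : Set.Ici (0 : ℝ) ⊆
      Set.Ico 0 t₀ ∪ ⋃ k, Set.Ico (grid θ t₀ k) (grid θ t₀ (k + 1)) := fun u hu => by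
    rcases lt_or_ge u t₀ with hlt | hge
    · exact Or.inl ⟨hu, hlt⟩
    · exact Or.inr (Set.mem_iUnion.2
        (exists_mem_Ico_of_tendsto_atTop (tendsto_grid hθ hθ₀) hge))
  have hinit : ∫⁻ t in Set.Ico 0 t₀, ENNReal.ofReal (gaussianWeight (θ t)) ≤ ENNReal.ofReal t₀ :=
    calc _ ≤ ∫⁻ _ in Set.Ico 0 t₀, 1 := lintegral_mono fun t => by
          simpa using gaussianWeight_le_one (θ t)
      _ = ENNReal.ofReal t₀ := by rw [setLIntegral_one, Real.volume_Ico, sub_zero]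
  have hcell : ∀ k, ∫⁻ t in Set.Ico (grid θ t₀ k) (grid θ t₀ (k + 1)),
      ENNReal.ofReal (gaussianWeight (θ t)) ≤
        ENNReal.ofReal (stake θ t₀ k) := fun k => by
    have hone := one_le_grid hθ hθ₀ k
    refine (setLIntegral_le_ofReal_mul_gaussianWeight hθ hone le_rfl).trans_eq ?_
    rw [grid_succ, add_sub_cancel_left, gaussianWeight, ← mul_assoc,
      one_div_mul_cancel (by linarith), one_mul, stake]
  calc _ ≤ _ := lintegral_mono_set hcover
    _ ≤ _ := lintegral_union_le _ _ _
    _ ≤ _ := add_le_add hinit ((lintegral_iUnion_le _ _).trans (ENNReal.tsum_le_tsum hcell))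

lemma not_summable_stake
    (hI : ∫⁻ t in Set.Ici (0 : ℝ), ENNReal.ofReal (gaussianWeight (θ t)) = ⊤) :
    ¬ Summable (stake θ t₀) := fun hsum =>
  ((lintegral_gaussianWeight_le hθ hθ₀).trans_lt
    (ENNReal.add_lt_top.2 ⟨ENNReal.ofReal_lt_top, hsum.tsum_ofReal_ne_top.lt_top⟩)).ne hI

lemma summable_indicator_stake_of_growing :
    Summable ({k | θ (grid θ t₀ k) ^ 2 + 1 < θ (grid θ t₀ k + 5) ^ 2}.indicator
      (stake θ t₀)) := by
  have hone := one_le_grid hθ hθ₀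
  refine summable_indicator_exp_of_sparse (fun k => sq_nonneg _) fun k hk l _ hkl hfloor => ?_
  have hk : θ (grid θ t₀ k) ^ 2 + 1 < θ (grid θ t₀ k + 5) ^ 2 := hk
  have hclose : grid θ t₀ l < grid θ t₀ k + 5 := by
    by_contra! hfar
    have hsq : θ (grid θ t₀ k + 5) ^ 2 ≤ θ (grid θ t₀ l) ^ 2 := by
      gcongr
      · linarith [hone k, hθ (show grid θ t₀ k ≤ grid θ t₀ k + 5 by linarith)]
      · exact hθ hfar
    have hl := Nat.lt_floor_add_one (θ (grid θ t₀ l) ^ 2)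
    rw [← hfloor] at hl
    linarith [Nat.floor_le (sq_nonneg (θ (grid θ t₀ k)))]
  nlinarith [hone l, sub_le_mul_grid_sub hθ hθ₀ hkl.le (le_refl (θ (grid θ t₀ l)))]

lemma summable_indicator_stake_of_jump :
    Summable ({k | 3 * θ (grid θ t₀ k - 8 * Real.log (θ (grid θ t₀ k))) <
      θ (grid θ t₀ k)}.indicator (stake θ t₀)) := by
  have hone := one_le_grid hθ hθ₀
  refine summable_indicator_exp_of_sparse (fun k => sq_nonneg _) fun k _ l hl hkl hfloor => ?_
  have hl : 3 * θ (grid θ t₀ l - 8 * Real.log (θ (grid θ t₀ l))) < θ (grid θ t₀ l) := hl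
  have hclose : grid θ t₀ l - grid θ t₀ k < 8 * Real.log (θ (grid θ t₀ l)) := by
    by_contra! hfar
    have hkl' : θ (grid θ t₀ k) ≤ θ (grid θ t₀ l - 8 * Real.log (θ (grid θ t₀ l))) :=
      hθ (by linarith)
    have hl' := Nat.lt_floor_add_one (θ (grid θ t₀ l) ^ 2)
    rw [← hfloor] at hl'
    nlinarith [hone k, hone l, Nat.floor_le (sq_nonneg (θ (grid θ t₀ k)))]
  have hlog := Real.log_le_sub_one_of_pos (by linarith [hone l] : 0 < θ (grid θ t₀ l))
  nlinarith [hone l, sub_le_mul_grid_sub hθ hθ₀ hkl.le (le_refl (θ (grid θ t₀ l)))]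

lemma not_summable_indicator_stake
    (hI : ∫⁻ t in Set.Ici (0 : ℝ), ENNReal.ofReal (gaussianWeight (θ t)) = ⊤) :
    ¬ Summable ((regularIndices θ t₀).indicator (stake θ t₀)) := fun hregular => by
  have hcompl : (regularIndices θ t₀)ᶜ =
      {k | θ (grid θ t₀ k) ^ 2 + 1 < θ (grid θ t₀ k + 5) ^ 2} ∪
        {k | 3 * θ (grid θ t₀ k - 8 * Real.log (θ (grid θ t₀ k))) < θ (grid θ t₀ k)} := by
    ext k
    simp only [regularIndices, Set.mem_compl_iff, Set.mem_union, Set.mem_ofPred_eq, not_and_or,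
      not_le]
  have hirregular := summable_indicator_union (fun k => (stake_pos k).le)
    (summable_indicator_stake_of_growing hθ hθ₀) (summable_indicator_stake_of_jump hθ hθ₀)
  have hsum := hregular.add (hcompl ▸ hirregular)
  simp only [Set.indicator_self_add_compl_apply] at hsum
  exact not_summable_stake hθ hθ₀ hI hsum

end LowerGrid

section GaussianDecay

lemma exists_sum_exp_neg_abs_le :
    ∃ B : ℝ, 0 ≤ B ∧ ∀ (K : Finset ℕ) (k₀ : ℕ),
      ∑ k ∈ K, Real.exp (1 - |(k : ℝ) - k₀| / 64) ≤ B := by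
  have hsum : Summable fun n : ℤ => Real.exp (1 - |(n : ℝ)| / 64) := by
    have hgeom := (Real.summable_pow_mul_exp_neg_nat_mul 0
      (show (0 : ℝ) < 1 / 64 by norm_num)).mul_left (Real.exp 1)
    have hnat : Summable fun n : ℕ => Real.exp (1 - |((n : ℤ) : ℝ)| / 64) := by
      refine hgeom.congr fun n => ?_
      rw [pow_zero, one_mul, ← Real.exp_add, Int.cast_natCast, Nat.abs_cast]
      ring_nf
    exact Summable.of_nat_of_neg hnat (hnat.congr fun n => by simp)
  refine ⟨∑' n : ℤ, Real.exp (1 - |(n : ℝ)| / 64), tsum_nonneg fun n => (Real.exp_pos _).le,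
    fun K k₀ => ?_⟩
  have hinj : Set.InjOn (fun k : ℕ => (k : ℤ) - k₀) K := fun a _ b _ h => by simpa using h
  calc ∑ k ∈ K, Real.exp (1 - |(k : ℝ) - k₀| / 64)
      = ∑ n ∈ K.image fun k : ℕ => (k : ℤ) - k₀, Real.exp (1 - |(n : ℝ)| / 64) := by
        rw [Finset.sum_image hinj]
        push_cast
        rfl
    _ ≤ _ := hsum.sum_le_tsum _ fun n _ => (Real.exp_pos _).le

lemma neg_sq_mul_exp_sub_one_sq_le {D u j : ℝ} (hD : 0 ≤ D) (hu : 0 ≤ u) (hj : j ≤ 4 * D * u) :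
    -(D ^ 2 * (Real.exp u - 1) ^ 2 / 2) ≤ 1 - j / 64 := by
  have hlin : D * u ≤ D * (Real.exp u - 1) := by
    gcongr
    linarith [Real.add_one_le_exp u]
  have hsq : (D * u) ^ 2 ≤ (D * (Real.exp u - 1)) ^ 2 := by gcongr
  nlinarith [sq_nonneg (D * u - 1), mul_nonneg hD hu]

lemma neg_sq_mul_exp_neg_sub_one_sq_le {D v j : ℝ} (hD : 1 ≤ D) (hv : 0 ≤ v)
    (hj : j ≤ 1 + 2 * D * v) (hbig : 1 < D ^ 2 * Real.exp (-v)) :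
    -(D ^ 2 * (Real.exp (-v) - 1) ^ 2 / 2) ≤ 1 - j / 64 := by
  set r := Real.exp (-v) with hr
  have hr0 : 0 < r := Real.exp_pos _
  have hexp : Real.exp v * r = 1 := by rw [hr, ← Real.exp_add, add_neg_cancel, Real.exp_zero]
  have hrv : (1 + v) * r ≤ 1 := by
    rw [← hexp]
    gcongr
    linarith [Real.add_one_le_exp v]
  rcases le_total v 1 with hv1 | hv1
  · have hlin : D * (v / 2) ≤ D * (1 - r) := by
      gcongr
      nlinarith
    have hsq : (D * (v / 2)) ^ 2 ≤ (D * (1 - r)) ^ 2 := by gcongr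
    nlinarith [sq_nonneg (D * v - 2), mul_nonneg (by linarith : 0 ≤ D) hv]
  · have hvD : v ≤ 2 * D := by
      have hlog : v < Real.log (D ^ 2) := by
        rw [Real.lt_log_iff_exp_lt (by positivity)]
        nlinarith [Real.exp_pos v]
      rw [Real.log_pow, Nat.cast_ofNat] at hlog
      linarith [Real.log_le_sub_one_of_pos (by linarith : 0 < D)]
    have hhalf : D * (1 / 2) ≤ D * (1 - r) := by
      gcongr
      nlinarith
    have hsq : (D * (1 / 2)) ^ 2 ≤ (D * (1 - r)) ^ 2 := by gcongr
    nlinarith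

variable {θ : ℝ → ℝ} {t₀ : ℝ}

lemma gaussian_exponent_le (hθ : Monotone θ) (hθ₀ : 1 ≤ θ t₀) {h : ℝ} {k k₀ : ℕ}
    (hk₀ : h ∈ Set.Ico (grid θ t₀ k₀) (grid θ t₀ (k₀ + 1))) (hk : k ∈ regularIndices θ t₀)
    (hactive : h ≤ grid θ t₀ k + 5)
    (hbig : 1 < θ (grid θ t₀ k) ^ 2 * Real.exp ((h - grid θ t₀ k) / 2)) :
    -(θ (grid θ t₀ k) ^ 2 * (Real.exp ((h - grid θ t₀ k) / 2) - 1) ^ 2 / 2) ≤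
      1 - |(k : ℝ) - k₀| / 64 := by
  obtain ⟨hk₀, hk₀'⟩ := hk₀
  have hmono := (strictMono_grid hθ hθ₀).monotone
  have hD := one_le_grid hθ hθ₀ k
  rcases Nat.lt_or_ge k₀ k with hlt | hge
  · have hτ : grid θ t₀ (k₀ + 1) ≤ grid θ t₀ k := hmono hlt
    have hcount := sub_le_mul_grid_sub hθ hθ₀ (show k₀ + 1 ≤ k from hlt) le_rfl
    push_cast at hcount
    rw [abs_of_nonneg (sub_nonneg.2 (Nat.cast_le.2 hlt.le))]
    rw [show (h - grid θ t₀ k) / 2 = -((grid θ t₀ k - h) / 2) by ring] at hbig ⊢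
    exact neg_sq_mul_exp_neg_sub_one_sq_le hD (by linarith) (by nlinarith) hbig
  · have hτ : grid θ t₀ k ≤ grid θ t₀ k₀ := hmono hge
    have hdouble : θ (grid θ t₀ k₀) ≤ 2 * θ (grid θ t₀ k) := by
      have hle : θ (grid θ t₀ k₀) ≤ θ (grid θ t₀ k + 5) := hθ (by linarith)
      nlinarith [hk.1, one_le_grid hθ hθ₀ k₀]
    have hcount := sub_le_mul_grid_sub hθ hθ₀ hge hdouble
    rw [abs_sub_comm, abs_of_nonneg (sub_nonneg.2 (Nat.cast_le.2 hge))]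
    exact neg_sq_mul_exp_sub_one_sq_le (by linarith) (by linarith) (by nlinarith)

end GaussianDecay

section LevelBet

/-- The paths that stay below the boundary `θ` between the times `N` and `i`, and whose announced
bounds are small compared with the clock up to time `i`. -/
def admissible {Ω : Type*} (S c : ℕ → Ω → ℝ) (θ : ℝ → ℝ) (t₀ C : ℝ) (N i : ℕ) : Set Ω :=
  {ω | (∀ j ≤ i, N ≤ j →
      S j ω < Real.exp (logClock S t₀ j ω / 2) * θ (logClock S t₀ j ω)) ∧
    ∀ j ≤ i, c (j + 1) ω * θ (logClock S t₀ j ω) ^ 3 ≤ C * Real.exp (logClock S t₀ j ω / 2)}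

/-- The paths on which the bet of level `τ` is active at time `i`: betting starts at time `N` and
stops when the path ceases to be admissible or the clock exceeds `τ + 4`. -/
def bettingRegion {Ω : Type*} (S c : ℕ → Ω → ℝ) (θ : ℝ → ℝ) (t₀ C : ℝ) (N : ℕ) (τ : ℝ) (i : ℕ) :
    Set Ω :=
  {ω | N ≤ i ∧ ω ∈ admissible S c θ t₀ C N i ∧ logClock S t₀ i ω ≤ τ + 4}

/-- The bet of level `τ`, designed to be lucrative when the boundary is approached while the clock
is close to `τ`. -/
noncomputable def levelBet {Ω : Type*} (S c : ℕ → Ω → ℝ) (θ : ℝ → ℝ) (t₀ C : ℝ) (N : ℕ) (τ : ℝ)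
    (i : ℕ) : Ω → ℝ :=
  (bettingRegion S c θ t₀ C N τ i).indicator fun _ => θ τ / Real.exp (τ / 2)

/-- The levels `τ` whose bets are efficient: `θ` varies little around `τ`, and `τ` is so large that
whatever happened before the clock and the path exceeded `L` is negligible. -/
structure GoodLevel (θ : ℝ → ℝ) (t₀ C L τ : ℝ) : Prop where
  nonneg : 0 ≤ τ
  le_add_one : θ (τ + 5) ^ 2 ≤ θ τ ^ 2 + 1
  le_three_mul : θ τ ≤ 3 * θ (τ - 8 * Real.log (θ τ))
  large : 432 * C ≤ θ τ
  remote : θ τ * (L + Real.exp t₀) ≤ Real.exp (τ / 2)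

variable {Ω : Type*} {S c : ℕ → Ω → ℝ} {θ : ℝ → ℝ} {t₀ C L τ : ℝ} {N i n : ℕ} {ω : Ω}

lemma admissible_antitone : Antitone (admissible S c θ t₀ C N) :=
  fun _ _ hij _ hω => ⟨fun l hl => hω.1 l (hl.trans hij), fun l hl => hω.2 l (hl.trans hij)⟩

lemma admissible_mono_start {m : ℕ} (hmN : m ≤ N) :
    admissible S c θ t₀ C m i ⊆ admissible S c θ t₀ C N i :=
  fun _ hω => ⟨fun j hj hNj => hω.1 j hj (hmN.trans hNj), hω.2⟩

lemma mem_bettingRegion_of_le {j : ℕ} (hNi : N ≤ i) (hij : i ≤ j)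
    (hω : ω ∈ admissible S c θ t₀ C N j) (hclock : logClock S t₀ j ω ≤ τ + 4) :
    ω ∈ bettingRegion S c θ t₀ C N τ i :=
  ⟨hNi, admissible_antitone hij hω, (monotone_logClock ω hij).trans hclock⟩

lemma levelBet_of_mem (hω : ω ∈ bettingRegion S c θ t₀ C N τ i) :
    levelBet S c θ t₀ C N τ i ω = θ τ / Real.exp (τ / 2) :=
  Set.indicator_of_mem hω _

lemma levelBet_of_notMem (hω : ω ∉ bettingRegion S c θ t₀ C N τ i) :
    levelBet S c θ t₀ C N τ i ω = 0 :=
  Set.indicator_of_notMem hω _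

lemma levelBet_of_lt (hi : i < N) (ω : Ω) : levelBet S c θ t₀ C N τ i ω = 0 :=
  levelBet_of_notMem fun hω => hi.not_ge hω.1

lemma measurableSet_admissible {mΩ : MeasurableSpace Ω} {ℱ : Filtration ℕ mΩ}
    (hS : StronglyAdapted ℱ S) (hc : ∀ i, Measurable[ℱ i] (c (i + 1))) (hθ : Monotone θ) (i : ℕ) :
    MeasurableSet[ℱ i] (admissible S c θ t₀ C N i) := by
  have hexp : ∀ j, Measurable[ℱ j] fun ω => Real.exp (logClock S t₀ j ω / 2) := fun j =>
    Real.measurable_exp.comp ((measurable_logClock hS j).div_const 2)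
  have hθm : ∀ j, Measurable[ℱ j] fun ω => θ (logClock S t₀ j ω) := fun j =>
    hθ.measurable.comp (measurable_logClock hS j)
  simp only [admissible, Set.ofPred_and, Set.ofPred_forall]
  refine .inter ?_ ?_ <;> refine .iInter fun j => .iInter fun hj => ?_
  · exact .iInter fun _ => ℱ.mono hj _
      (measurableSet_lt (hS j).measurable ((hexp j).mul (hθm j)))
  · exact ℱ.mono hj _
      (measurableSet_le ((hc j).mul ((hθm j).pow_const 3)) ((hexp j).const_mul C))

lemma measurableSet_bettingRegion {mΩ : MeasurableSpace Ω} {ℱ : Filtration ℕ mΩ}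
    (hS : StronglyAdapted ℱ S) (hc : ∀ i, Measurable[ℱ i] (c (i + 1))) (hθ : Monotone θ) (i : ℕ) :
    MeasurableSet[ℱ i] (bettingRegion S c θ t₀ C N τ i) :=
  (MeasurableSet.const _).inter ((measurableSet_admissible hS hc hθ i).inter
    (measurableSet_le (measurable_logClock hS i) measurable_const))

lemma div_exp_mul_exp (D τ h : ℝ) :
    D / Real.exp (τ / 2) * Real.exp (h / 2) = D * Real.exp ((h - τ) / 2) := by
  rw [sub_div, Real.exp_sub]
  ring

lemma div_exp_sq_mul_exp (D τ h : ℝ) :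
    (D / Real.exp (τ / 2)) ^ 2 * Real.exp h = (D * Real.exp ((h - τ) / 2)) ^ 2 := by
  rw [← div_exp_mul_exp, mul_pow, sq (Real.exp (h / 2)), ← Real.exp_add, add_halves]

lemma exp_half_sub_le_thirteen {h : ℝ} (hh : h ≤ τ + 5) : Real.exp ((h - τ) / 2) ≤ 13 := by
  have hexp : Real.exp 1 ^ 5 ≤ 13 ^ 2 :=
    (pow_le_pow_left₀ (Real.exp_pos 1).le Real.exp_one_lt_d9.le 5).trans (by norm_num)
  rw [← Real.exp_nat_mul] at hexp
  refine le_of_sq_le_sq ?_ (by norm_num)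
  rw [← Real.exp_nat_mul]
  refine le_trans (Real.exp_le_exp.2 ?_) hexp
  push_cast
  linarith

namespace GoodLevel

lemma delta_le_half (hτ : GoodLevel θ t₀ C L τ) (hC : 1 ≤ C) : 216 * C / θ τ ^ 2 ≤ 1 / 2 := by
  have hlarge := hτ.large
  rw [div_le_iff₀ (by nlinarith)]
  nlinarith

lemma mul_le_sq_add_half (hτ : GoodLevel θ t₀ C L τ) (hC : 1 ≤ C) (hθ : Monotone θ) {h : ℝ}
    (hh : h ≤ τ + 5) : θ τ * θ h ≤ θ τ ^ 2 + 1 / 2 := by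
  have hD : 432 ≤ θ τ := by linarith [hτ.large]
  rcases le_total h τ with hle | hge
  · nlinarith [hθ hle]
  · have hsq : θ h ^ 2 ≤ θ (τ + 5) ^ 2 := by
      gcongr
      · linarith [hθ hge]
      · exact hθ hh
    nlinarith [hτ.le_add_one, sq_nonneg (θ h - θ τ)]

variable (hτ : GoodLevel θ t₀ C L τ) (hC : 1 ≤ C) (hθ : Monotone θ) (hθ₀ : 1 ≤ θ t₀)
  (hx : ∀ i, |S (i + 1) ω - S i ω| ≤ c (i + 1) ω)
include hτ hC hθ hθ₀ hx

lemma abs_mul_increment_le (hω : ω ∈ bettingRegion S c θ t₀ C N τ i) :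
    |θ τ / Real.exp (τ / 2) * (S (i + 1) ω - S i ω)| ≤ 216 * C / θ τ ^ 2 := by
  have hD : 1 ≤ θ τ := by linarith [hτ.large]
  refine SelfNormalized.abs_mul_increment_le (by positivity) (hx i) ?_
  exact div_exp_mul_le hθ (by linarith) hD hτ.le_three_mul hω.2.2 ((abs_nonneg _).trans (hx i))
    (hθ₀.trans (hθ (le_logClock i ω))) (hω.2.1.2 i le_rfl)

lemma abs_levelBet_mul_le (i : ℕ) :
    |levelBet S c θ t₀ C N τ i ω * (S (i + 1) ω - S i ω)| ≤ 1 / 2 :=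
  abs_indicator_mul_le one_half_pos.le fun hω =>
    (hτ.abs_mul_increment_le hC hθ hθ₀ hx hω).trans (hτ.delta_le_half hC)

lemma abs_increment_le_exp (hω : ω ∈ bettingRegion S c θ t₀ C N τ i) :
    |S (i + 1) ω - S i ω| ≤ Real.exp (τ / 2) := by
  have hD : 1 ≤ θ τ := by linarith [hτ.large]
  have hstep := (hτ.abs_mul_increment_le hC hθ hθ₀ hx hω).trans (hτ.delta_le_half hC)
  rw [abs_mul, abs_of_nonneg (by positivity), div_mul_eq_mul_div,
    div_le_iff₀ (Real.exp_pos _)] at hstep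
  nlinarith [abs_nonneg (S (i + 1) ω - S i ω), Real.exp_pos (τ / 2)]

lemma logClock_le_add_five (hL : quadVar S N ω ≤ L) (hn : N ≤ n)
    (hω : ∀ i ∈ Finset.Ico N n, ω ∈ bettingRegion S c θ t₀ C N τ i) :
    logClock S t₀ n ω ≤ τ + 5 := by
  have hD : 1 ≤ θ τ := by linarith [hτ.large]
  rcases hn.eq_or_lt with rfl | hlt
  · have hstart : Real.exp (logClock S t₀ N ω) ≤ Real.exp (τ / 2) :=
      calc Real.exp (logClock S t₀ N ω) ≤ L + Real.exp t₀ := by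
            linarith [exp_logClock_le (S := S) (t₀ := t₀) N ω]
        _ ≤ θ τ * (L + Real.exp t₀) := by
            have hL0 := (quadVar_nonneg N ω).trans hL
            exact le_mul_of_one_le_left (by positivity) hD
        _ ≤ Real.exp (τ / 2) := hτ.remote
    linarith [Real.exp_le_exp.1 hstart, hτ.nonneg]
  · obtain ⟨m, rfl⟩ := Nat.exists_eq_add_one.2 (Nat.zero_lt_of_lt hlt)
    have hm := hω m (Finset.mem_Ico.2 ⟨Nat.lt_succ_iff.1 hlt, m.lt_succ_self⟩)
    have hsq : (S (m + 1) ω - S m ω) ^ 2 ≤ Real.exp τ := by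
      rw [← sq_abs, ← add_halves τ, Real.exp_add, ← sq]
      exact pow_le_pow_left₀ (abs_nonneg _) (hτ.abs_increment_le_exp hC hθ hθ₀ hx hm) 2
    rw [← Real.exp_le_exp]
    calc Real.exp (logClock S t₀ (m + 1) ω)
        ≤ Real.exp (logClock S t₀ m ω) + (S (m + 1) ω - S m ω) ^ 2 := exp_logClock_succ_le m ω
      _ ≤ Real.exp (τ + 4) + Real.exp (τ + 4) := by
          gcongr
          · exact hm.2.2
          · exact hsq.trans (Real.exp_le_exp.2 (by linarith))
      _ ≤ Real.exp (τ + 4) * Real.exp 1 := by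
          nlinarith [Real.add_one_le_exp 1, Real.exp_pos (τ + 4)]
      _ = Real.exp (τ + 5) := by
          rw [← Real.exp_add]
          ring_nf

end GoodLevel

lemma isSafeBet_levelBet {mΩ : MeasurableSpace Ω} {P : Measure Ω} {ℱ : Filtration ℕ mΩ}
    (hS : StronglyAdapted ℱ S) (hc : ∀ i, Measurable[ℱ i] (c (i + 1)))
    (hx : ∀ᵐ ω ∂P, ∀ i, |S (i + 1) ω - S i ω| ≤ c (i + 1) ω) (hτ : GoodLevel θ t₀ C L τ)
    (hC : 1 ≤ C) (hθ : Monotone θ) (hθ₀ : 1 ≤ θ t₀) :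
    IsSafeBet ℱ P S (levelBet S c θ t₀ C N τ) :=
  .of_indicator (measurableSet_bettingRegion hS hc hθ) fun _ => hx.mono fun _ hxω hω =>
    (hτ.abs_mul_increment_le hC hθ hθ₀ hxω hω).trans (hτ.delta_le_half hC)

end LevelBet

section LevelWealth

variable {Ω : Type*} {S c : ℕ → Ω → ℝ} {θ : ℝ → ℝ} {t₀ C L τ : ℝ} {N n : ℕ} {ω : Ω}

lemma GoodLevel.remote_sq (hτ : GoodLevel θ t₀ C L τ) (hC : 1 ≤ C) (ht₀ : 0 ≤ t₀) (hL : 0 ≤ L) :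
    (θ τ / Real.exp (τ / 2)) ^ 2 * (L + Real.exp t₀) ≤ 1 := by
  have hD : 0 ≤ θ τ := by linarith [hτ.large]
  have hremote : θ τ / Real.exp (τ / 2) * (L + Real.exp t₀) ≤ 1 := by
    rw [div_mul_eq_mul_div, div_le_one (Real.exp_pos _)]
    exact hτ.remote
  have hone : θ τ / Real.exp (τ / 2) ≤ 1 :=
    (le_mul_of_one_le_right (by positivity) (by linarith [Real.one_le_exp ht₀])).trans hremote
  rw [sq, mul_assoc]
  exact mul_le_one₀ hone (by positivity) hremote

lemma GoodLevel.mul_sub_le (hτ : GoodLevel θ t₀ C L τ) (hC : 1 ≤ C) (hθ : Monotone θ)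
    (hSN : |S N ω| ≤ L) {h : ℝ} (hh : h ≤ τ + 5) (hcross : S n ω < Real.exp (h / 2) * θ h) :
    θ τ / Real.exp (τ / 2) * (S n ω - S N ω) ≤
      θ τ ^ 2 * Real.exp ((h - τ) / 2) + 8 := by
  have hD : 0 ≤ θ τ := by linarith [hτ.large]
  set lam := θ τ / Real.exp (τ / 2) with hlam
  have hstart : lam * -S N ω ≤ 1 := by
    rw [hlam, div_mul_eq_mul_div, div_le_one (Real.exp_pos _)]
    refine le_trans ?_ hτ.remote
    gcongr
    linarith [neg_le_of_abs_le hSN, Real.exp_pos t₀]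
  have hend : lam * S n ω ≤ θ τ ^ 2 * Real.exp ((h - τ) / 2) + 7 :=
    calc lam * S n ω ≤ lam * (Real.exp (h / 2) * θ h) := by gcongr
      _ = θ τ * θ h * Real.exp ((h - τ) / 2) := by
          rw [← mul_assoc, hlam, div_exp_mul_exp]
          ring
      _ ≤ (θ τ ^ 2 + 1 / 2) * Real.exp ((h - τ) / 2) := by
          gcongr
          exact hτ.mul_le_sq_add_half hC hθ hh
      _ ≤ _ := by linarith [exp_half_sub_le_thirteen hh]
  linarith

lemma GoodLevel.neg_mul_quadVar_sub_le (hτ : GoodLevel θ t₀ C L τ) (hC : 1 ≤ C) (ht₀ : 0 ≤ t₀)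
    (hQN : quadVar S N ω ≤ L) (hclock : logClock S t₀ n ω ≤ τ + 5) :
    -((1 / 2 - 2 * (216 * C / θ τ ^ 2)) *
        ((θ τ / Real.exp (τ / 2)) ^ 2 * (quadVar S n ω - quadVar S N ω))) ≤
      1 / 2 + 432 * 169 * C - (θ τ * Real.exp ((logClock S t₀ n ω - τ) / 2)) ^ 2 / 2 := by
  have hD : 0 < θ τ := by linarith [hτ.large]
  have hQN0 := quadVar_nonneg (S := S) N ω
  set lam := θ τ / Real.exp (τ / 2)
  set r := Real.exp ((logClock S t₀ n ω - τ) / 2)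
  have hscale : lam ^ 2 * Real.exp (logClock S t₀ n ω) = (θ τ * r) ^ 2 := div_exp_sq_mul_exp ..
  have hmain : (θ τ * r) ^ 2 - 1 ≤ lam ^ 2 * (quadVar S n ω - quadVar S N ω) := by
    have hclock' := exp_logClock_le (S := S) (t₀ := t₀) n ω
    calc (θ τ * r) ^ 2 - 1
        ≤ lam ^ 2 * Real.exp (logClock S t₀ n ω) - lam ^ 2 * (L + Real.exp t₀) := by
          rw [hscale]
          linarith [hτ.remote_sq hC ht₀ (hQN0.trans hQN)]
      _ = lam ^ 2 * (Real.exp (logClock S t₀ n ω) - (L + Real.exp t₀)) := by ring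
      _ ≤ _ := mul_le_mul_of_nonneg_left (by linarith) (sq_nonneg lam)
  have herror : 2 * (216 * C / θ τ ^ 2) * (lam ^ 2 * (quadVar S n ω - quadVar S N ω)) ≤
      432 * 169 * C :=
    calc _ ≤ 2 * (216 * C / θ τ ^ 2) * (lam ^ 2 * Real.exp (logClock S t₀ n ω)) := by
          gcongr
          linarith [quadVar_le_exp_logClock (S := S) (t₀ := t₀) n ω]
      _ = 432 * C * r ^ 2 := by
          rw [hscale]
          field_simp
          ring
      _ ≤ 432 * C * 13 ^ 2 := by
          gcongr
          exact exp_half_sub_le_thirteen hclock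
      _ = 432 * 169 * C := by ring
  linarith

/-- The constant by which the wealth of a bet may exceed that of the corresponding bet on a
continuous path. -/
noncomputable def wealthFactor (C : ℝ) : ℝ :=
  Real.exp (9 + 432 * 169 * C)

lemma wealthFactor_pos : 0 < wealthFactor C :=
  Real.exp_pos _

variable (hτ : GoodLevel θ t₀ C L τ) (hC : 1 ≤ C) (hθ : Monotone θ) (ht₀ : 0 ≤ t₀)
  (hθ₀ : 1 ≤ θ t₀) (hx : ∀ i, |S (i + 1) ω - S i ω| ≤ c (i + 1) ω) (hSN : |S N ω| ≤ L)
  (hQN : quadVar S N ω ≤ L)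
include hτ hC hθ ht₀ hθ₀ hx hSN hQN

lemma wealth_levelBet_le (hn : N ≤ n)
    (hω : ∀ i ∈ Finset.Ico N n, ω ∈ bettingRegion S c θ t₀ C N τ i)
    (hcross : S n ω < Real.exp (logClock S t₀ n ω / 2) * θ (logClock S t₀ n ω)) :
    wealth S (levelBet S c θ t₀ C N τ) n ω ≤ wealthFactor C *
      Real.exp (θ τ ^ 2 * Real.exp ((logClock S t₀ n ω - τ) / 2) -
        (θ τ * Real.exp ((logClock S t₀ n ω - τ) / 2)) ^ 2 / 2) := by
  have hclock := hτ.logClock_le_add_five hC hθ hθ₀ hx hQN hn hω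
  refine (wealth_le_exp hn (fun i hi => levelBet_of_lt hi ω)
    (fun i hi => levelBet_of_mem (hω i hi)) (hτ.delta_le_half hC)
    fun i hi => hτ.abs_mul_increment_le hC hθ hθ₀ hx (hω i hi)).trans ?_
  rw [wealthFactor, ← Real.exp_add]
  refine Real.exp_le_exp.2 ?_
  linarith [hτ.mul_sub_le hC hθ hSN hclock hcross, hτ.neg_mul_quadVar_sub_le hC ht₀ hQN hclock]

lemma wealth_levelBet_le_quarter (hn : N ≤ n) (hadm : ω ∈ admissible S c θ t₀ C N n)
    (hclock : τ + 4 < logClock S t₀ n ω) : wealth S (levelBet S c θ t₀ C N τ) n ω ≤ 1 / 4 := by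
  classical
  have hex : ∃ m, N ≤ m ∧ τ + 4 < logClock S t₀ m ω := ⟨n, hn, hclock⟩
  obtain ⟨hNm, hm⟩ := Nat.find_spec hex
  have hmn : Nat.find hex ≤ n := Nat.find_min' hex ⟨hn, hclock⟩
  have hactive : ∀ i ∈ Finset.Ico N (Nat.find hex), ω ∈ bettingRegion S c θ t₀ C N τ i :=
    fun i hi => by
      obtain ⟨hNi, him⟩ := Finset.mem_Ico.1 hi
      exact ⟨hNi, admissible_antitone (him.le.trans hmn) hadm,
        not_lt.1 fun hlt => Nat.find_min hex him ⟨hNi, hlt⟩⟩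
  have hinactive : ∀ i ∈ Finset.Ico (Nat.find hex) n, levelBet S c θ t₀ C N τ i ω = 0 :=
    fun i hi => levelBet_of_notMem fun hmem =>
      (hm.trans_le (monotone_logClock ω (Finset.mem_Ico.1 hi).1)).not_ge hmem.2.2
  have hexp2 : 4 ≤ Real.exp 2 := by
    rw [show (2 : ℝ) = 1 + 1 by norm_num, Real.exp_add]
    nlinarith [Real.add_one_le_exp 1]
  set r := Real.exp ((logClock S t₀ (Nat.find hex) ω - τ) / 2)
  have hr : 4 ≤ r := hexp2.trans (Real.exp_le_exp.2 (by linarith))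
  calc wealth S (levelBet S c θ t₀ C N τ) n ω
      = wealth S (levelBet S c θ t₀ C N τ) (Nat.find hex) ω := wealth_eq_of_eq_zero hmn hinactive
    _ ≤ wealthFactor C * Real.exp (θ τ ^ 2 * r - (θ τ * r) ^ 2 / 2) :=
        wealth_levelBet_le hτ hC hθ ht₀ hθ₀ hx hSN hQN hNm hactive (hadm.1 _ hmn hNm)
    _ ≤ Real.exp (-2) := by
        have hD : 432 * C * 432 ≤ θ τ ^ 2 := by nlinarith [hτ.large]
        rw [wealthFactor, ← Real.exp_add]
        refine Real.exp_le_exp.2 ?_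
        nlinarith [mul_nonneg (sq_nonneg (θ τ)) (by nlinarith : 0 ≤ r ^ 2 / 2 - r - 4)]
    _ ≤ 1 / 4 := by
        rw [Real.exp_neg, one_div]
        exact inv_anti₀ (by norm_num) hexp2

end LevelWealth

section Mixture

/-- The wealth of the mixture of the bets attached to the grid points with indices in `K`, the
capital `stake θ t₀ k` being invested in the bet of index `k`. -/
noncomputable def mixture {Ω : Type*} (S c : ℕ → Ω → ℝ) (θ : ℝ → ℝ) (t₀ C : ℝ) (N : ℕ)
    (K : Finset ℕ) (n : ℕ) (ω : Ω) : ℝ :=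
  ∑ k ∈ K, stake θ t₀ k * wealth S (levelBet S c θ t₀ C N (grid θ t₀ k)) n ω

variable {Ω : Type*} {S c : ℕ → Ω → ℝ} {θ : ℝ → ℝ} {t₀ C L : ℝ} {N n : ℕ} {ω : Ω}

lemma GoodLevel.mem_regularIndices {k : ℕ} (hk : GoodLevel θ t₀ C L (grid θ t₀ k)) :
    k ∈ regularIndices θ t₀ :=
  ⟨hk.le_add_one, hk.le_three_mul⟩

lemma one_le_wealthFactor (hC : 0 ≤ C) : 1 ≤ wealthFactor C :=
  Real.one_le_exp (by positivity)

lemma exp_neg_half_sq_mul_exp_le {D r a : ℝ} (h : 1 < D ^ 2 * r → -(D ^ 2 * (r - 1) ^ 2 / 2) ≤ a) :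
    Real.exp (-D ^ 2 / 2) * Real.exp (D ^ 2 * r - (D * r) ^ 2 / 2) ≤
      3 * Real.exp (-D ^ 2 / 2) + Real.exp a := by
  rcases le_or_gt (D ^ 2 * r) 1 with hle | hgt
  · have hexp : Real.exp (D ^ 2 * r - (D * r) ^ 2 / 2) ≤ 3 :=
      (Real.exp_le_exp.2 (by nlinarith [sq_nonneg (D * r)])).trans Real.exp_one_lt_three.le
    nlinarith [Real.exp_pos (-D ^ 2 / 2), Real.exp_pos a]
  · rw [← Real.exp_add, show -D ^ 2 / 2 + (D ^ 2 * r - (D * r) ^ 2 / 2) =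
      -(D ^ 2 * (r - 1) ^ 2 / 2) by ring]
    exact (Real.exp_le_exp.2 (h hgt)).trans (le_add_of_nonneg_left (by positivity))

variable (hC : 1 ≤ C) (hθ : Monotone θ) (hθ₀ : 1 ≤ θ t₀)
  (hx : ∀ i, |S (i + 1) ω - S i ω| ≤ c (i + 1) ω)

section Single

variable (ht₀ : 0 ≤ t₀) (hSN : |S N ω| ≤ L) (hQN : quadVar S N ω ≤ L)
include hC hθ hθ₀ hx ht₀ hSN hQN

lemma stake_mul_wealth_levelBet_le {k k₀ : ℕ} (hk : GoodLevel θ t₀ C L (grid θ t₀ k))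
    (hn : N ≤ n) (hadm : ω ∈ admissible S c θ t₀ C N n)
    (hk₀ : logClock S t₀ n ω ∈ Set.Ico (grid θ t₀ k₀) (grid θ t₀ (k₀ + 1))) :
    stake θ t₀ k * wealth S (levelBet S c θ t₀ C N (grid θ t₀ k)) n ω ≤
      wealthFactor C * (3 * stake θ t₀ k + Real.exp (1 - |(k : ℝ) - k₀| / 64)) := by
  have hE := one_le_wealthFactor (zero_le_one.trans hC)
  have hw := stake_pos (θ := θ) (t₀ := t₀) k
  have hdecay := Real.exp_pos (1 - |(k : ℝ) - k₀| / 64)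
  rcases le_or_gt (logClock S t₀ n ω) (grid θ t₀ k + 4) with hclock | hclock
  · have hactive : ∀ i ∈ Finset.Ico N n, ω ∈ bettingRegion S c θ t₀ C N (grid θ t₀ k) i :=
      fun i hi => mem_bettingRegion_of_le (Finset.mem_Ico.1 hi).1 (Finset.mem_Ico.1 hi).2.le
        hadm hclock
    set r := Real.exp ((logClock S t₀ n ω - grid θ t₀ k) / 2)
    calc stake θ t₀ k * wealth S (levelBet S c θ t₀ C N (grid θ t₀ k)) n ω
        ≤ stake θ t₀ k * (wealthFactor C *
            Real.exp (θ (grid θ t₀ k) ^ 2 * r - (θ (grid θ t₀ k) * r) ^ 2 / 2)) := by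
          gcongr
          exact wealth_levelBet_le hk hC hθ ht₀ hθ₀ hx hSN hQN hn hactive (hadm.1 n le_rfl hn)
      _ = wealthFactor C * (stake θ t₀ k *
            Real.exp (θ (grid θ t₀ k) ^ 2 * r - (θ (grid θ t₀ k) * r) ^ 2 / 2)) :=
          mul_left_comm _ _ _
      _ ≤ _ := by
          gcongr
          exact exp_neg_half_sq_mul_exp_le (gaussian_exponent_le hθ hθ₀ hk₀ hk.mem_regularIndices
            (by linarith))
  · have hquarter := wealth_levelBet_le_quarter hk hC hθ ht₀ hθ₀ hx hSN hQN hn hadm hclock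
    nlinarith [mul_pos hw hdecay]

lemma mixture_le_of_mem_admissible {K : Finset ℕ} (hK : ∀ k ∈ K, GoodLevel θ t₀ C L (grid θ t₀ k))
    (hsum : ∑ k ∈ K, stake θ t₀ k ≤ 2) {B : ℝ}
    (hB : ∀ k₀ : ℕ, ∑ k ∈ K, Real.exp (1 - |(k : ℝ) - k₀| / 64) ≤ B) (hn : N ≤ n)
    (hadm : ω ∈ admissible S c θ t₀ C N n) :
    mixture S c θ t₀ C N K n ω ≤ wealthFactor C * (6 + B) := by
  obtain ⟨k₀, hk₀⟩ := exists_mem_Ico_of_tendsto_atTop (tendsto_grid hθ hθ₀)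
    (le_logClock (S := S) (t₀ := t₀) n ω)
  calc mixture S c θ t₀ C N K n ω
      ≤ ∑ k ∈ K, wealthFactor C * (3 * stake θ t₀ k + Real.exp (1 - |(k : ℝ) - k₀| / 64)) :=
        Finset.sum_le_sum fun k hk =>
          stake_mul_wealth_levelBet_le hC hθ hθ₀ hx ht₀ hSN hQN (hK k hk) hn hadm hk₀
    _ = wealthFactor C *
          (3 * ∑ k ∈ K, stake θ t₀ k + ∑ k ∈ K, Real.exp (1 - |(k : ℝ) - k₀| / 64)) := by
        rw [← Finset.mul_sum, Finset.sum_add_distrib, Finset.mul_sum]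
    _ ≤ wealthFactor C * (6 + B) :=
        mul_le_mul_of_nonneg_left (by linarith [hB k₀]) wealthFactor_pos.le

lemma eventually_mixture_le_half {K : Finset ℕ}
    (hK : ∀ k ∈ K, GoodLevel θ t₀ C L (grid θ t₀ k)) (hsum : ∑ k ∈ K, stake θ t₀ k ≤ 2)
    (hadm : ∀ i, ω ∈ admissible S c θ t₀ C N i)
    (hclock : Tendsto (fun n => logClock S t₀ n ω) atTop atTop) :
    ∀ᶠ n in atTop, mixture S c θ t₀ C N K n ω ≤ 1 / 2 := by
  have hlate : ∀ᶠ n in atTop, ∀ k ∈ K, grid θ t₀ k + 4 < logClock S t₀ n ω :=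
    (Finset.eventually_all K).2 fun k _ => hclock.eventually_gt_atTop _
  filter_upwards [hlate, eventually_ge_atTop N] with n hn hNn
  calc mixture S c θ t₀ C N K n ω ≤ ∑ k ∈ K, stake θ t₀ k * (1 / 4) :=
        Finset.sum_le_sum fun k hk => mul_le_mul_of_nonneg_left (wealth_levelBet_le_quarter
          (hK k hk) hC hθ ht₀ hθ₀ hx hSN hQN hNn (hadm n) (hn k hk)) (stake_pos k).le
    _ = (∑ k ∈ K, stake θ t₀ k) * (1 / 4) := (Finset.sum_mul ..).symm
    _ ≤ 1 / 2 := by linarith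

end Single

lemma mixture_zero (K : Finset ℕ) : mixture S c θ t₀ C N K 0 ω = ∑ k ∈ K, stake θ t₀ k := by
  simp only [mixture, wealth_zero, mul_one]

include hC hθ hθ₀ hx in
lemma mixture_succ_le {K : Finset ℕ} (hK : ∀ k ∈ K, GoodLevel θ t₀ C L (grid θ t₀ k)) (n : ℕ) :
    mixture S c θ t₀ C N K (n + 1) ω ≤ 3 / 2 * mixture S c θ t₀ C N K n ω := by
  rw [mixture, mixture, Finset.mul_sum]
  refine Finset.sum_le_sum fun k hk => ?_
  rw [mul_left_comm]
  exact mul_le_mul_of_nonneg_left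
    (wealth_succ_le ((hK k hk).abs_levelBet_mul_le hC hθ hθ₀ hx) n) (stake_pos k).le

lemma mixture_succ_of_not (K : Finset ℕ) (h : ¬ (N ≤ n ∧ ω ∈ admissible S c θ t₀ C N n)) :
    mixture S c θ t₀ C N K (n + 1) ω = mixture S c θ t₀ C N K n ω := by
  refine Finset.sum_congr rfl fun k _ => ?_
  rw [wealth_succ, levelBet_of_notMem fun hω => h ⟨hω.1, hω.2.1⟩, zero_mul, add_zero, mul_one]

include hC hθ hθ₀ in
lemma exists_mixture_le (ht₀ : 0 ≤ t₀) :
    ∃ B : ℝ, 2 ≤ B ∧ ∀ (S c : ℕ → Ω → ℝ) (L : ℝ) (N : ℕ) (K : Finset ℕ),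
      (∀ k ∈ K, GoodLevel θ t₀ C L (grid θ t₀ k)) → ∑ k ∈ K, stake θ t₀ k ≤ 2 →
      ∀ ω, (∀ i, |S (i + 1) ω - S i ω| ≤ c (i + 1) ω) → |S N ω| ≤ L → quadVar S N ω ≤ L →
        ∀ n, mixture S c θ t₀ C N K n ω ≤ B := by
  obtain ⟨B, hB0, hB⟩ := exists_sum_exp_neg_abs_le
  have hE := wealthFactor_pos (C := C)
  refine ⟨2 + 3 / 2 * (wealthFactor C * (6 + B)), le_add_of_nonneg_right (by positivity),
    fun S c L N K hK hsum ω hx hSN hQN n => ?_⟩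
  induction n with
  | zero =>
    rw [mixture_zero]
    exact hsum.trans (le_add_of_nonneg_right (by positivity))
  | succ n ih =>
    by_cases hactive : N ≤ n ∧ ω ∈ admissible S c θ t₀ C N n
    · linarith [mixture_succ_le (N := N) hC hθ hθ₀ hx hK n,
        mixture_le_of_mem_admissible hC hθ hθ₀ hx ht₀ hSN hQN hK hsum (hB K) hactive.1 hactive.2]
    · rwa [mixture_succ_of_not K hactive]

end Mixture

section ZeroOne

variable {Ω : Type*} {mΩ : MeasurableSpace Ω} {P : Measure Ω}

lemma measure_setOf_le_inter_le [IsFiniteMeasure P] {X : Ω → ℝ} (hX : Integrable X P) {F : Set Ω}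
    (hF : MeasurableSet F) {a B : ℝ} (haB : a < B) (hXB : ∀ᵐ ω ∂P, ω ∈ F → X ω ≤ B)
    (hmean : P.real F ≤ ∫ ω in F, X ω ∂P) :
    P ({ω | X ω ≤ a} ∩ F) ≤ ENNReal.ofReal ((B - 1) / (B - a)) * P F := by
  have hmarkov := mul_meas_ge_le_integral_of_nonneg (μ := P.restrict F) (f := fun ω => B - X ω)
    ((ae_restrict_iff' hF).2 (hXB.mono fun ω hω hωF => sub_nonneg.2 (hω hωF)))
    ((integrable_const B).sub hX.integrableOn) (B - a)
  have hmean' : ∫ ω in F, (B - X ω) ∂P ≤ (B - 1) * P.real F := by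
    rw [integral_sub (integrable_const B) hX.integrableOn, setIntegral_const, smul_eq_mul]
    linarith
  simp only [sub_le_sub_iff_left, measureReal_restrict_apply' hF] at hmarkov
  rw [← ofReal_measureReal (s := _ ∩ F), ← ofReal_measureReal (s := F),
    ← ENNReal.ofReal_mul' measureReal_nonneg]
  refine ENNReal.ofReal_le_ofReal ?_
  rw [div_mul_eq_mul_div, le_div_iff₀ (sub_pos.2 haB)]
  linarith

lemma measure_le_of_ae_eventually_mem {G : Set Ω} {A : ℕ → Set Ω} {b : ENNReal}
    (hG : ∀ᵐ ω ∂P, ω ∈ G → ∀ᶠ n in atTop, ω ∈ A n) (hA : ∀ᶠ n in atTop, P (A n) ≤ b) :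
    P G ≤ b := by
  have hmono : Monotone fun m => ⋂ n ∈ Set.Ici m, A n :=
    fun _ _ hlm => Set.biInter_subset_biInter_left (Set.Ici_subset_Ici.2 hlm)
  have hcover : ∀ᵐ ω ∂P, ω ∈ G → ω ∈ ⋃ m, ⋂ n ∈ Set.Ici m, A n := hG.mono fun ω hω hωG => by
    obtain ⟨m, hm⟩ := eventually_atTop.1 (hω hωG)
    exact Set.mem_iUnion.2 ⟨m, Set.mem_iInter₂.2 hm⟩
  calc P G ≤ P (⋃ m, ⋂ n ∈ Set.Ici m, A n) := measure_mono_ae hcover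
    _ = ⨆ m, P (⋂ n ∈ Set.Ici m, A n) := hmono.measure_iUnion
    _ ≤ b := iSup_le fun m => by
        obtain ⟨n, hn, hmn⟩ := (hA.and (eventually_ge_atTop m)).exists
        exact (measure_mono (Set.biInter_subset_of_mem hmn)).trans hn

variable [IsFiniteMeasure P]

lemma ae_condExp_indicator_le {m : MeasurableSpace Ω} (hm : m ≤ mΩ) {G : Set Ω}
    (hG : MeasurableSet[mΩ] G) {ρ : ℝ} (hρ : 0 ≤ ρ)
    (h : ∀ F, MeasurableSet[m] F → P (G ∩ F) ≤ ENNReal.ofReal ρ * P F) :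
    ∀ᵐ ω ∂P, (P[G.indicator (fun _ => (1 : ℝ)) | m]) ω ≤ ρ := by
  have hint : Integrable (G.indicator fun _ => (1 : ℝ)) P := (integrable_const 1).indicator hG
  refine ae_le_of_ae_le_trim (hm := hm) (f₂ := fun _ => ρ) (ae_le_of_forall_setIntegral_le
    (integrable_condExp.trim hm stronglyMeasurable_condExp) (integrable_const ρ) fun F hF _ => ?_)
  have hreal : P.real (G ∩ F) ≤ ρ * P.real F := by
    have := ENNReal.toReal_mono (by finiteness) (h F hF)
    rwa [ENNReal.toReal_mul, ENNReal.toReal_ofReal hρ] at this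
  rw [← setIntegral_trim hm stronglyMeasurable_condExp hF,
    ← setIntegral_trim hm stronglyMeasurable_const hF, setIntegral_condExp hm hint hF,
    setIntegral_indicator hG, setIntegral_const, setIntegral_const, smul_eq_mul, smul_eq_mul,
    mul_one, Set.inter_comm, mul_comm]
  exact hreal

lemma measure_eq_zero_of_forall_inter_le {ℱ : Filtration ℕ mΩ} {G : Set Ω}
    (hG : MeasurableSet[⨆ n, ℱ n] G) {ρ : ℝ} (hρ₀ : 0 ≤ ρ) (hρ : ρ < 1) {m : ℕ}
    (h : ∀ n, m ≤ n → ∀ F, MeasurableSet[ℱ n] F → P (G ∩ F) ≤ ENNReal.ofReal ρ * P F) :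
    P G = 0 := by
  have hle : (⨆ n, ℱ n) ≤ mΩ := iSup_le ℱ.le
  have hbound : ∀ᵐ ω ∂P, ∀ n, m ≤ n → (P[G.indicator (fun _ => (1 : ℝ)) | ℱ n]) ω ≤ ρ :=
    ae_all_iff.2 fun n => eventually_imp_distrib_left.2 fun hn =>
      ae_condExp_indicator_le (ℱ.le n) (hle G hG) hρ₀ (h n hn)
  have hlevy := tendsto_ae_condExp (μ := P) (ℱ := ℱ) (G.indicator fun _ => (1 : ℝ))
  rw [condExp_of_stronglyMeasurable hle (stronglyMeasurable_const.indicator hG)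
    ((integrable_const 1).indicator (hle G hG))] at hlevy
  rw [measure_eq_zero_iff_ae_notMem]
  filter_upwards [hlevy, hbound] with ω hlim hω hωG
  rw [Set.indicator_of_mem hωG] at hlim
  exact hρ.not_ge (le_of_tendsto hlim ((eventually_ge_atTop m).mono hω))

end ZeroOne

section Lower

/-- The paths that stay below the boundary `θ` from time `m` on although the clock runs to infinity,
and whose announced bounds are small compared with the clock. -/
def neverCrossing {Ω : Type*} (S c : ℕ → Ω → ℝ) (θ : ℝ → ℝ) (t₀ C : ℝ) (m : ℕ) : Set Ω :=
  (⋂ i, admissible S c θ t₀ C m i) ∩ {ω | Tendsto (fun n => logClock S t₀ n ω) atTop atTop}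

variable {Ω : Type*} {mΩ : MeasurableSpace Ω} {P : Measure Ω} {ℱ : Filtration ℕ mΩ}
  {S c : ℕ → Ω → ℝ} {θ ψ : ℝ → ℝ} {t₀ C L : ℝ} {N n m : ℕ} {K : Finset ℕ}

lemma measurableSet_neverCrossing (hS : StronglyAdapted ℱ S)
    (hc : ∀ i, Measurable[ℱ i] (c (i + 1))) (hθ : Monotone θ) :
    MeasurableSet[⨆ n, ℱ n] (neverCrossing S c θ t₀ C m) := by
  have hle : ∀ n, ℱ n ≤ ⨆ n, ℱ n := le_iSup fun n => ℱ n
  exact .inter (.iInter fun i => hle i _ (measurableSet_admissible hS hc hθ i))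
    (measurableSet_tendsto atTop fun n => (measurable_logClock hS n).mono (hle n) le_rfl)

lemma eventually_goodLevel (hθ : Monotone θ) (hθtop : Tendsto θ atTop atTop)
    (hθ₀ : 1 ≤ θ t₀) (C L : ℝ) :
    ∀ᶠ k in atTop, k ∈ regularIndices θ t₀ → GoodLevel θ t₀ C L (grid θ t₀ k) := by
  have hgrid := tendsto_grid hθ hθ₀
  have hexp : Tendsto (fun t : ℝ => Real.exp (3 / 8 * t)) atTop atTop :=
    Real.tendsto_exp_atTop.comp (tendsto_id.const_mul_atTop (by norm_num))
  filter_upwards [hgrid.eventually_ge_atTop 0,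
    hgrid.eventually (hθtop.eventually_ge_atTop (432 * C)),
    hgrid.eventually (hθtop.eventually_gt_atTop (3 * θ 0)),
    hgrid.eventually (hexp.eventually_ge_atTop (L + Real.exp t₀))]
    with k hnonneg hlarge hzero hstart hk
  have hD := one_le_grid hθ hθ₀ k
  refine ⟨hnonneg, hk.1, hk.2, hlarge, ?_⟩
  have hlog : 0 < grid θ t₀ k - 8 * Real.log (θ (grid θ t₀ k)) := by
    by_contra! hneg
    linarith [hk.2, hθ hneg]
  have hle : θ (grid θ t₀ k) ≤ Real.exp (grid θ t₀ k / 8) := by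
    rw [← Real.log_le_iff_le_exp (by linarith)]
    linarith
  calc θ (grid θ t₀ k) * (L + Real.exp t₀)
      ≤ θ (grid θ t₀ k) * Real.exp (3 / 8 * grid θ t₀ k) := by gcongr
    _ ≤ Real.exp (grid θ t₀ k / 8) * Real.exp (3 / 8 * grid θ t₀ k) := by gcongr
    _ = Real.exp (grid θ t₀ k / 2) := by
        rw [← Real.exp_add]
        ring_nf

lemma exists_goodLevel_sum_mem_Icc (hθ : Monotone θ) (hθtop : Tendsto θ atTop atTop)
    (hθ₀ : 1 ≤ θ t₀)
    (hI : ∫⁻ t in Set.Ici (0 : ℝ), ENNReal.ofReal (gaussianWeight (θ t)) = ⊤) (C L : ℝ) :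
    ∃ K : Finset ℕ, (∀ k ∈ K, GoodLevel θ t₀ C L (grid θ t₀ k)) ∧
      ∑ k ∈ K, stake θ t₀ k ∈ Set.Icc (1 : ℝ) 2 := by
  classical
  obtain ⟨k₁, hk₁⟩ := eventually_atTop.1 (eventually_goodLevel hθ hθtop hθ₀ C L)
  obtain ⟨n, hn⟩ := exists_sum_Ico_mem_Icc
    (Set.indicator_nonneg fun k _ => (stake_pos k).le)
    (fun k => Set.indicator_apply_le' (fun _ => stake_le_one k) fun _ => zero_le_one)
    (not_summable_indicator_stake hθ hθ₀ hI) k₁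
  refine ⟨(Finset.Ico k₁ n).filter (· ∈ regularIndices θ t₀), fun k hk => ?_, ?_⟩
  · obtain ⟨hk, hkr⟩ := Finset.mem_filter.1 hk
    exact hk₁ k (Finset.mem_Ico.1 hk).1 hkr
  · rwa [Finset.sum_filter]

lemma integrable_mixture [IsFiniteMeasure P]
    (hb : ∀ k ∈ K, IsSafeBet ℱ P S (levelBet S c θ t₀ C N (grid θ t₀ k)))
    (hS : StronglyAdapted ℱ S) (n : ℕ) : Integrable (mixture S c θ t₀ C N K n) P :=
  integrable_finsetSum _ fun k hk => ((hb k hk).integrable_wealth hS n).const_mul _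

lemma setIntegral_mixture [IsFiniteMeasure P]
    (hb : ∀ k ∈ K, IsSafeBet ℱ P S (levelBet S c θ t₀ C N (grid θ t₀ k)))
    (hS : Martingale S ℱ P) (hn : N ≤ n) {F : Set Ω} (hF : MeasurableSet[ℱ N] F) :
    ∫ ω in F, mixture S c θ t₀ C N K n ω ∂P = (∑ k ∈ K, stake θ t₀ k) * P.real F := by
  unfold mixture
  rw [integral_finsetSum _ fun k hk =>
    (((hb k hk).integrable_wealth hS.stronglyAdapted n).const_mul _).integrableOn, Finset.sum_mul]
  refine Finset.sum_congr rfl fun k hk => ?_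
  rw [integral_const_mul, (hb k hk).setIntegral_wealth hS hn (fun i hi => levelBet_of_lt hi) hF]

variable [IsFiniteMeasure P] (hS : Martingale S ℱ P)
  (hc : ∀ i, Measurable[ℱ i] (c (i + 1)))
  (hx : ∀ᵐ ω ∂P, ∀ i, |S (i + 1) ω - S i ω| ≤ c (i + 1) ω)
include hS hc hx

lemma measure_neverCrossing_inter_le_of_mixture_le (hC : 1 ≤ C) (hθ : Monotone θ) (ht₀ : 0 ≤ t₀)
    (hθ₀ : 1 ≤ θ t₀) (hK : ∀ k ∈ K, GoodLevel θ t₀ C L (grid θ t₀ k))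
    (hsum : ∑ k ∈ K, stake θ t₀ k ∈ Set.Icc (1 : ℝ) 2) {B : ℝ} (hB2 : 2 ≤ B)
    (hB : ∀ ω, (∀ i, |S (i + 1) ω - S i ω| ≤ c (i + 1) ω) → |S N ω| ≤ L → quadVar S N ω ≤ L →
      ∀ n, mixture S c θ t₀ C N K n ω ≤ B)
    {F : Set Ω} (hF : MeasurableSet[ℱ N] F) (hFL : ∀ ω ∈ F, |S N ω| ≤ L ∧ quadVar S N ω ≤ L) :
    P (neverCrossing S c θ t₀ C N ∩ F) ≤ ENNReal.ofReal ((B - 1) / (B - 1 / 2)) * P F := by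
  have hb : ∀ k ∈ K, IsSafeBet ℱ P S (levelBet S c θ t₀ C N (grid θ t₀ k)) :=
    fun k hk => isSafeBet_levelBet hS.stronglyAdapted hc hx (hK k hk) hC hθ hθ₀
  refine measure_le_of_ae_eventually_mem
    (A := fun n => {ω | mixture S c θ t₀ C N K n ω ≤ 1 / 2} ∩ F) ?_ ?_
  · filter_upwards [hx] with ω hxω ⟨⟨hadm, hclock⟩, hωF⟩
    exact (eventually_mixture_le_half hC hθ hθ₀ hxω ht₀ (hFL ω hωF).1 (hFL ω hωF).2 hK hsum.2
      (Set.mem_iInter.1 hadm) hclock).mono fun n hn => ⟨hn, hωF⟩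
  · filter_upwards [eventually_ge_atTop N] with n hn
    refine measure_setOf_le_inter_le (integrable_mixture hb hS.stronglyAdapted n) (ℱ.le N F hF)
      (by linarith) (hx.mono fun ω hxω hωF => hB ω hxω (hFL ω hωF).1 (hFL ω hωF).2 n) ?_
    rw [setIntegral_mixture hb hS hn hF]
    exact le_mul_of_one_le_left measureReal_nonneg hsum.1

lemma exists_measure_neverCrossing_inter_le (hC : 1 ≤ C) (hθ : Monotone θ)
    (hθtop : Tendsto θ atTop atTop) (ht₀ : 0 ≤ t₀) (hθ₀ : 1 ≤ θ t₀)
    (hI : ∫⁻ t in Set.Ici (0 : ℝ), ENNReal.ofReal (gaussianWeight (θ t)) = ⊤) :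
    ∃ ρ : ℝ, 0 ≤ ρ ∧ ρ < 1 ∧ ∀ N F, MeasurableSet[ℱ N] F →
      P (neverCrossing S c θ t₀ C N ∩ F) ≤ ENNReal.ofReal ρ * P F := by
  obtain ⟨B, hB2, hB⟩ := exists_mixture_le (Ω := Ω) hC hθ hθ₀ ht₀
  refine ⟨(B - 1) / (B - 1 / 2), div_nonneg (by linarith) (by linarith),
    (div_lt_one (by linarith)).2 (by linarith), fun N F hF => ?_⟩
  refine measure_le_of_ae_eventually_mem (A := fun L : ℕ => neverCrossing S c θ t₀ C N ∩
    (F ∩ {ω | |S N ω| ≤ L ∧ quadVar S N ω ≤ L})) (ae_of_all _ fun ω ⟨hω, hωF⟩ => ?_)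
    (Eventually.of_forall fun L => ?_)
  · filter_upwards [eventually_ge_atTop ⌈max |S N ω| (quadVar S N ω)⌉₊] with L hL
    exact ⟨hω, hωF, max_le_iff.1 (Nat.ceil_le.1 hL)⟩
  · obtain ⟨K, hK, hsum⟩ := exists_goodLevel_sum_mem_Icc hθ hθtop hθ₀ hI C L
    have hbdd : MeasurableSet[ℱ N] {ω | |S N ω| ≤ L ∧ quadVar S N ω ≤ L} :=
      (measurableSet_le (measurable_abs.comp (hS.stronglyAdapted N).measurable)
        measurable_const).inter
        (measurableSet_le (measurable_quadVar hS.stronglyAdapted N) measurable_const)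
    refine (measure_neverCrossing_inter_le_of_mixture_le hS hc hx hC hθ ht₀ hθ₀ hK hsum hB2
      (hB S c L N K hK hsum.2) (hF.inter hbdd) fun ω hω => hω.2).trans ?_
    gcongr
    exact Set.inter_subset_left

lemma measure_neverCrossing_eq_zero (hC : 1 ≤ C) (hθ : Monotone θ)
    (hθtop : Tendsto θ atTop atTop) (ht₀ : 0 ≤ t₀) (hθ₀ : 1 ≤ θ t₀)
    (hI : ∫⁻ t in Set.Ici (0 : ℝ), ENNReal.ofReal (gaussianWeight (θ t)) = ⊤) (m : ℕ) :
    P (neverCrossing S c θ t₀ C m) = 0 := by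
  obtain ⟨ρ, hρ₀, hρ, h⟩ :=
    exists_measure_neverCrossing_inter_le hS hc hx hC hθ hθtop ht₀ hθ₀ hI
  refine measure_eq_zero_of_forall_inter_le (measurableSet_neverCrossing hS.stronglyAdapted hc hθ)
    hρ₀ hρ (m := m) fun N hmN F hF => (measure_mono ?_).trans (h N F hF)
  exact Set.inter_subset_inter_left F (Set.inter_subset_inter_left _
    (Set.iInter_mono fun i => admissible_mono_start hmN))

omit hS hc hx in
lemma exists_mem_neverCrossing {ω : Ω} (hmono : MonotoneOn ψ (Set.Ici 1))
    (htop : Tendsto ψ atTop atTop) (ht₀ : 0 ≤ t₀)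
    (hx : ∀ i, |S (i + 1) ω - S i ω| ≤ c (i + 1) ω) (hω : ω ∈ growthEvent S c ψ)
    (hbelow : ∀ᶠ n in atTop, S n ω < normalizer S n ω * ψ (quadVar S n ω)) :
    ∃ C : ℕ, 1 ≤ C ∧ ∃ m, ω ∈ neverCrossing S c (logProfile ψ) t₀ C m := by
  have hQ := tendsto_quadVar_of_mem_growthEvent hω
  obtain ⟨C, hC1, hC⟩ := exists_step_bound hmono htop ht₀ hx hω
  obtain ⟨m, hm⟩ := eventually_atTop.1 (hbelow.and (hQ.eventually_ge_atTop (Real.exp t₀)))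
  refine ⟨C, hC1, m, Set.mem_iInter.2 fun i => ⟨fun j _ hmj => ?_, fun j _ => hC j⟩,
    tendsto_logClock hQ⟩
  obtain ⟨hlt, hQj⟩ := hm j hmj
  rwa [← normalizer_eq_exp_logClock hQj, logProfile_logClock ht₀ hQj]

theorem ae_frequently_le_of_efkpIntegral_eq_top (hmono : MonotoneOn ψ (Set.Ici 1))
    (hI : efkpIntegral ψ = ⊤) (htop : Tendsto ψ atTop atTop) :
    ∀ᵐ ω ∂P, ω ∈ growthEvent S c ψ →
      ∃ᶠ n in atTop, normalizer S n ω * ψ (quadVar S n ω) ≤ S n ω := by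
  have hθ := monotone_logProfile hmono
  have hθtop := tendsto_logProfile_iff.2 htop
  obtain ⟨t₀, hθ₀, ht₀⟩ :=
    ((hθtop.eventually_ge_atTop 1).and (eventually_ge_atTop 0)).exists
  rw [efkpIntegral_eq_lintegral_logProfile] at hI
  have hnull : ∀ᵐ ω ∂P, ∀ C : ℕ, 1 ≤ C → ∀ m, ω ∉ neverCrossing S c (logProfile ψ) t₀ C m :=
    ae_all_iff.2 fun C => eventually_imp_distrib_left.2 fun hC => ae_all_iff.2 fun m =>
      measure_eq_zero_iff_ae_notMem.1 (measure_neverCrossing_eq_zero hS hc hx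
        (Nat.one_le_cast.2 hC) hθ hθtop ht₀ hθ₀ hI m)
  filter_upwards [hx, hnull] with ω hxω hω hgrowth
  by_contra hcross
  simp only [not_frequently, not_le] at hcross
  obtain ⟨C, hC, m, hmem⟩ := exists_mem_neverCrossing hmono htop ht₀ hxω hgrowth hcross
  exact hω C hC m hmem

end Lower

end SelfNormalized

theorem theorem1_general {Ω : Type*} [mΩ : MeasurableSpace Ω] (P : Measure Ω) [IsFiniteMeasure P]
    (ℱ : Filtration ℕ mΩ) (S c : ℕ → Ω → ℝ) (ψ : ℝ → ℝ)
    (hS : Martingale S ℱ P)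
    (hc_meas : ∀ n : ℕ, 1 ≤ n → Measurable[ℱ (n - 1)] (c n))
    (hc_bound : ∀ n : ℕ, 1 ≤ n → ∀ᵐ ω ∂P, |SelfNormalized.increment S n ω| ≤ c n ω)
    (hψ_pos : ∀ t ∈ Set.Ici (1 : ℝ), 0 < ψ t)
    (hψ_mono : MonotoneOn ψ (Set.Ici (1 : ℝ))) :
    (SelfNormalized.efkpIntegral ψ < ⊤ →
      ∀ᵐ ω ∂P, ω ∈ SelfNormalized.growthEvent S c ψ →
        ∀ᶠ n in atTop,
          S n ω < SelfNormalized.normalizer S n ω * ψ (SelfNormalized.quadVar S n ω)) ∧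
    (SelfNormalized.efkpIntegral ψ = ⊤ → Tendsto ψ atTop atTop →
      ∀ᵐ ω ∂P, ω ∈ SelfNormalized.growthEvent S c ψ →
        ∃ᶠ n in atTop,
          SelfNormalized.normalizer S n ω * ψ (SelfNormalized.quadVar S n ω) ≤ S n ω) := by
  have hc : ∀ i, Measurable[ℱ i] (c (i + 1)) := fun i => hc_meas (i + 1) (Nat.le_add_left 1 i)
  have hx : ∀ᵐ ω ∂P, ∀ i, |S (i + 1) ω - S i ω| ≤ c (i + 1) ω :=
    ae_all_iff.2 fun i => hc_bound (i + 1) (Nat.le_add_left 1 i)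
  exact ⟨SelfNormalized.ae_eventually_lt_of_efkpIntegral_lt_top hS hc hx hψ_pos hψ_mono,
    SelfNormalized.ae_frequently_le_of_efkpIntegral_eq_top hS hc hx hψ_mono⟩

theorem theorem1 {Ω : Type*} [mΩ : MeasurableSpace Ω] (P : Measure Ω) [IsProbabilityMeasure P]
    (ℱ : Filtration ℕ mΩ) (S c : ℕ → Ω → ℝ) (ψ : ℝ → ℝ)
    (hS : Martingale S ℱ P)
    (hS0 : ∀ᵐ ω ∂P, S 0 ω = 0)
    (hc_meas : ∀ n : ℕ, 1 ≤ n → Measurable[ℱ (n - 1)] (c n))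
    (hc_bound : ∀ n : ℕ, 1 ≤ n → ∀ᵐ ω ∂P, |SelfNormalized.increment S n ω| ≤ c n ω)
    (hψ_pos : ∀ t ∈ Set.Ici (1 : ℝ), 0 < ψ t)
    (hψ_mono : MonotoneOn ψ (Set.Ici (1 : ℝ)))
    (hψ_cont : ContinuousOn ψ (Set.Ici (1 : ℝ))) :
    (SelfNormalized.efkpIntegral ψ < ⊤ →
      ∀ᵐ ω ∂P, ω ∈ SelfNormalized.growthEvent S c ψ →
        ∀ᶠ n in atTop,
          S n ω < SelfNormalized.normalizer S n ω * ψ (SelfNormalized.quadVar S n ω)) ∧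
    (SelfNormalized.efkpIntegral ψ = ⊤ → Tendsto ψ atTop atTop →
      ∀ᵐ ω ∂P, ω ∈ SelfNormalized.growthEvent S c ψ →
        ∃ᶠ n in atTop,
          SelfNormalized.normalizer S n ω * ψ (SelfNormalized.quadVar S n ω) ≤ S n ω) :=
  theorem1_general P ℱ S c ψ hS hc_meas hc_bound hψ_pos hψ_mono
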